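/- All $\mathrm{C}^*$-algebras are unital, all $*$-homomorphisms preserve the unit, and a rational $*$-polynomial is a $*$-polynomial in finitely many noncommuting variables with coefficients in $\mathbb{Q}(i)$; a constant term is allowed and is read as a multiple of the unit. A \emph{finitely c.e. presentation} $A^\dagger=C^*\langle x_1,\dots,x_j \mid p_i(\bar x)=0,\ \|x_k\|\le C_k\rangle$ of a $\mathrm{C}^*$-algebra $A$ consists of finitely many rational $*$-polynomials $p_i$, nonnegative dyadic rationals $C_1,\dots,C_j$ and a tuple $x_1,\dots,x_j\in A$ satisfying these relations, such that $A$ with this tuple is universal: for every tuple $\bar z$ in a $\mathrm{C}^*$-algebra $B$ that satisfies the relations there is a unique $*$-homomorphism $\varphi:A\to B$ with $\varphi(x_k)=z_k$ for all $k$. Its \emph{rational points} are the elements $p(\bar x)$ with $p$ a rational $*$-polynomial. A $*$-homomorphism $\varphi$ is \emph{computable} from one presentation to another if there is an algorithm that, given a rational point $p$ of the first (named by its polynomial) and $k\in\mathbb{N}$, returns a rational point $q$ of the second with $\|\varphi(p)-q\|<2^{-k}$. The presentation $A^\dagger$ is \emph{computably weakly stable} if there is an algorithm which, given $n\in\mathbb{N}$,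 returns $m\in\mathbb{N}$ such that for every $\mathrm{C}^*$-algebra $B$ and every tuple $\bar z\in B$ with $\|p_i(\bar z)\|\le 2^{-m}$ for all $i$ and $\|z_k\|\le C_k+2^{-m}$ for all $k$, there is a $*$-homomorphism $\varphi:A\to B$ with $\|\varphi(x_k)-z_k\|<2^{-n}$ for all $k$. \textbf{Lemma.} Let $A^\dagger=C^*\langle x_1,\dots,x_j \mid p_i(\bar x)=0,\ \|x_k\|\le C_k\rangle$ and $A^\#=C^*\langle y_1,\dots,y_\ell \mid q_i(\bar y)=0,\ \|y_k\|\le D_k\rangle$ be finitely c.e. presentations of a $\mathrm{C}^*$-algebra $A$. If there is a $*$-isomorphism $\psi:A\to A$ that is computable from $A^\#$ to $A^\dagger$, and $A^\dagger$ is computably weakly stable, then $A^\#$ is computably weakly stable. Consequently, if there is a $*$-isomorphism $\psi:A\to A$ such that $\psi$ is computable from $A^\#$ to $A^\dagger$ and $\psi^{-1}$ is computable from $A^\dagger$ to $A^\#$, then $A^\dagger$ is computably weakly stable if and only if $A^\#$ is. In particular, computable weak stability does not depend on the chosen relations: if two finite sets of rational relations of the above form present $A$ as universal $\mathrm{C}^*$-algebra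 with the same tuple $\bar x$ of generators, then the one presentation is computably weakly stable if and only if the other is. -/

import Mathlib

universe u v

/-! All C*-algebras are unital and all `*`-homomorphisms preserve the unit
(`CStarAlgebra` and `→⋆ₐ[ℂ]`). -/

namespace FinCStar

/-- A code for a Gaussian rational: `((a, b), d)` stands for `(a + b i) / (d + 1)`. -/
abbrev GaussRat : Type := (ℤ × ℤ) × ℕ

/-- The complex number named by a code. -/
noncomputable def GaussRat.toComplex (c : GaussRat) : ℂ :=
  ((c.1.1 : ℂ) + (c.1.2 : ℂ) * Complex.I) / ((c.2 : ℂ) + 1)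

/-- A word in the letters `x₁, …, xₙ, x₁*, …, xₙ*`; the pair `(k, false)` is the letter `x_k` and
`(k, true)` is the letter `x_k*`. -/
abbrev StarWord (n : ℕ) : Type := List (Fin n × Bool)

/-- A rational `*`-polynomial in `n` noncommuting variables, that is, one with coefficients in
`ℚ(i)`, written as a finite formal sum of terms `(coefficient, word)`. The empty word stands for
the unit. As lists of finite data these form the type of inputs and outputs of algorithms. -/
abbrev RatStarPoly (n : ℕ) : Type := List (GaussRat × StarWord n)

section Eval

variable {B : Type v} [CStarAlgebra B] {n : ℕ}

/-- The value of a letter at a tuple. -/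
def letterEval (z : Fin n → B) (g : Fin n × Bool) : B :=
  if g.2 then star (z g.1) else z g.1

/-- The value of a word at a tuple. -/
def wordEval (z : Fin n → B) (w : StarWord n) : B :=
  (w.map (letterEval z)).prod

/-- The value `p(z₁, …, zₙ)` of a rational `*`-polynomial at a tuple in a C*-algebra. -/
noncomputable def polyEval (p : RatStarPoly n) (z : Fin n → B) : B :=
  (p.map fun t => GaussRat.toComplex t.1 • wordEval z t.2).sum

end Eval

/-- The finite set of rational relations `p(x) = 0` for `p ∈ rels`, and `‖x_k‖ ≤ bound k` for each
generator `x_k`, with nonnegative dyadic rational bounds. -/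
structure FinRelations (n : ℕ) where
  /-- the polynomials that are required to vanish -/
  rels : List (RatStarPoly n)
  /-- the norm bounds on the generators -/
  bound : Fin n → ℝ
  /-- the bounds are nonnegative dyadic rationals -/
  bound_dyadic : ∀ k, ∃ a b : ℕ, bound k = (a : ℝ) / 2 ^ b

/-- A representation of the relations: a tuple in a C*-algebra that satisfies all of them. -/
def FinRelations.IsRep {n : ℕ} (R : FinRelations n) {B : Type v} [CStarAlgebra B]
    (z : Fin n → B) : Prop :=
  (∀ p ∈ R.rels, polyEval p z = 0) ∧ ∀ k, ‖z k‖ ≤ R.bound k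

/-- The tuple `z` satisfies all relations up to an error of `δ`. -/
def FinRelations.IsApproxRep {n : ℕ} (R : FinRelations n) {B : Type v} [CStarAlgebra B]
    (δ : ℝ) (z : Fin n → B) : Prop :=
  (∀ p ∈ R.rels, ‖polyEval p z‖ ≤ δ) ∧ ∀ k, ‖z k‖ ≤ R.bound k + δ

/-- `A` together with the tuple `x` is the universal C*-algebra of the relations `R`. -/
def FinRelations.IsUniversal {n : ℕ} (R : FinRelations n) {A : Type u} [CStarAlgebra A]
    (x : Fin n → A) : Prop :=
  R.IsRep x ∧
    ∀ (B : Type u) [CStarAlgebra B] (z : Fin n → B), R.IsRep z →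
      ∃! φ : A →⋆ₐ[ℂ] B, ∀ k, φ (x k) = z k

/-- A finitely c.e. presentation of the C*-algebra `A` with `n` generators: finitely many rational
relations, and a tuple `pt` of special points that exhibits `A` as the universal C*-algebra of
these relations. -/
structure FinCEPresentation (A : Type u) [CStarAlgebra A] (n : ℕ) where
  /-- the defining relations -/
  toRelations : FinRelations n
  /-- the images of the generators in `A` -/
  pt : Fin n → A
  /-- `A` is the universal C*-algebra of the relations -/
  isUniversal : toRelations.IsUniversal pt

/-- The `*`-homomorphism `φ : A → C` is a computable map from the presentation of `A` with special
points `x` to the presentation of `C` with special points `y`: there is an algorithm that takes a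
rational point `p(x)` (given by `p`) and `k`, and returns a rational point `q(y)` (given by `q`)
with `‖φ(p(x)) - q(y)‖ < 2⁻ᵏ`. -/
def IsComputableMap {A : Type u} [CStarAlgebra A] {C : Type v} [CStarAlgebra C] {n m : ℕ}
    (x : Fin n → A) (y : Fin m → C) (φ : A →⋆ₐ[ℂ] C) : Prop :=
  ∃ F : RatStarPoly n × ℕ → RatStarPoly m, Computable F ∧
    ∀ (p : RatStarPoly n) (k : ℕ), ‖φ (polyEval p x) - polyEval (F (p, k)) y‖ < (1 / 2 : ℝ) ^ k

/-- The finitely c.e. presentation is computably weakly stable: there is an algorithm `n ↦ m` such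
that every `2⁻ᵐ`-approximate representation of the relations in a C*-algebra `B` is `2⁻ⁿ`-close on
the generators to a `*`-homomorphism `A → B`. -/
def FinCEPresentation.ComputablyWeaklyStable {A : Type u} [CStarAlgebra A] {j : ℕ}
    (P : FinCEPresentation A j) : Prop :=
  ∃ f : ℕ → ℕ, Computable f ∧
    ∀ (n : ℕ) (B : Type u) [CStarAlgebra B] (z : Fin j → B),
      P.toRelations.IsApproxRep ((1 / 2 : ℝ) ^ f n) z →
        ∃ φ : A →⋆ₐ[ℂ] B, ∀ k, ‖φ (P.pt k) - z k‖ < (1 / 2 : ℝ) ^ n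

end FinCStar

/-! Write `x` for `P.pt` and `y` for `Q.pt`. Computability of `ψ` gives polynomials `u` with `u(x)`
close to `ψ(y)`. Since rational points in `y` are dense, some tuple of polynomials `q` has `q(y)` so
close to `ψ⁻¹(x)` that `q(y)` almost satisfies the relations of `P` and `u(q(y))` is close to `y`.
If both facts persist at an approximate representation `z` of `Q`, then `w = q(z)` is an approximate
representation of `P`. Stability of `P` gives `θ : A → B` with `θ(x)` close to `w`, and `θ ∘ ψ` is
the required homomorphism: `θ(ψ(y)) ≈ u(θ(x)) ≈ u(w) = u(q(z)) ≈ z`.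

What remains is to find `q`, and a tolerance for `z`, by an algorithm. The conditions on `q` are
finitely many strict inequalities `‖p(y)‖ < r`, so it suffices to enumerate certified estimates
"`‖p(z)‖ ≤ r` at all `2⁻ᵈ`-approximate representations" and to search. The tuple `q` is found by
search as well, so `ψ⁻¹` need not be computable.

The estimates are derived by a calculus: sums, products, equality in the free `*`-algebra, the
C*-identity, the relations and the scalars. Soundness is `Valid.infer`. Completeness is
`Closed.exists_of_norm_lt`: the infimum of the derivable bounds is a C*-seminorm on the free
`*`-algebra over `ℚ(i)`. In its completion the generators satisfy the relations exactly, so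
universality of `A` gives a contractive homomorphism from `A`, and the seminorm of `p` is at most
`‖p(x)‖` for the universal tuple `x`. `exists_computable_modulus` turns this into a search, and
`of_isComputableMap` assembles the argument. -/

namespace FinCStar
open UniformSpace

/-! ### Arithmetic on codes of Gaussian rationals. -/

/-- addition of codes -/
def GaussRat.add (c c' : GaussRat) : GaussRat :=
  ((c.1.1 * (c'.2 + 1 : ℕ) + c'.1.1 * (c.2 + 1 : ℕ), c.1.2 * (c'.2 + 1 : ℕ) + c'.1.2 * (c.2 + 1 : ℕ)),
    c.2 * c'.2 + c.2 + c'.2)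

/-- multiplication of codes -/
def GaussRat.mul (c c' : GaussRat) : GaussRat :=
  ((c.1.1 * c'.1.1 + -(c.1.2 * c'.1.2), c.1.1 * c'.1.2 + c.1.2 * c'.1.1),
    c.2 * c'.2 + c.2 + c'.2)

/-- negation of codes -/
def GaussRat.neg (c : GaussRat) : GaussRat := ((-c.1.1, -c.1.2), c.2)

/-- conjugation of codes -/
def GaussRat.conj (c : GaussRat) : GaussRat := ((c.1.1, -c.1.2), c.2)

/-- the code of `0` -/
def GaussRat.zero : GaussRat := ((0, 0), 0)

/-- the code of `1` -/
def GaussRat.one : GaussRat := ((1, 0), 0)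

namespace GaussRat

theorem toComplex_zero : toComplex zero = 0 := by simp [toComplex, zero]

theorem toComplex_one : toComplex one = 1 := by simp [toComplex, one]

theorem toComplex_neg (c : GaussRat) : toComplex c.neg = -toComplex c := by
  simp only [toComplex, neg]; push_cast; ring

theorem toComplex_conj (c : GaussRat) : toComplex c.conj = star (toComplex c) := by
  simp [toComplex, conj]

theorem toComplex_add (c c' : GaussRat) : toComplex (c.add c') = toComplex c + toComplex c' := by
  have h (n : ℕ) : (n : ℂ) + 1 ≠ 0 := Nat.cast_add_one_ne_zero n
  have e : (((c.2 * c'.2 + c.2 + c'.2 : ℕ) : ℂ) + 1) = (c.2 + 1) * (c'.2 + 1) := by push_cast; ring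
  simp only [toComplex, add, e]
  have := h c.2
  have := h c'.2
  push_cast
  field_simp
  ring

theorem toComplex_mul (c c' : GaussRat) : toComplex (c.mul c') = toComplex c * toComplex c' := by
  have h (n : ℕ) : (n : ℂ) + 1 ≠ 0 := Nat.cast_add_one_ne_zero n
  have e : (((c.2 * c'.2 + c.2 + c'.2 : ℕ) : ℂ) + 1) = (c.2 + 1) * (c'.2 + 1) := by push_cast; ring
  simp only [toComplex, mul, e]
  have := h c.2
  have := h c'.2
  push_cast
  field_simp
  linear_combination (-(c.1.2 : ℂ) * c'.1.2) * Complex.I_sq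

/-- A number has many codes, but vanishing can be read off the numerators; this makes identities in
the free `*`-algebra decidable. -/
theorem toComplex_eq_zero_iff (c : GaussRat) : toComplex c = 0 ↔ c.1 = (0, 0) := by
  have h : (c.2 : ℂ) + 1 ≠ 0 := Nat.cast_add_one_ne_zero c.2
  rw [toComplex, div_eq_zero_iff, or_iff_left h]
  constructor
  · intro hc
    have h1 := congrArg Complex.re hc
    have h2 := congrArg Complex.im hc
    simp at h1 h2
    exact Prod.ext h1 h2
  · intro hc
    simp [hc]

end GaussRat

/-- The ring `ℚ(i)` of Gaussian rationals inside `ℂ`. -/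
def gaussRing : Subring ℂ where
  carrier := Set.range GaussRat.toComplex
  mul_mem' := by
    rintro _ _ ⟨a, rfl⟩ ⟨b, rfl⟩; exact ⟨a.mul b, GaussRat.toComplex_mul a b⟩
  one_mem' := ⟨GaussRat.one, GaussRat.toComplex_one⟩
  add_mem' := by
    rintro _ _ ⟨a, rfl⟩ ⟨b, rfl⟩; exact ⟨a.add b, GaussRat.toComplex_add a b⟩
  zero_mem' := ⟨GaussRat.zero, GaussRat.toComplex_zero⟩
  neg_mem' := by rintro _ ⟨a, rfl⟩; exact ⟨a.neg, GaussRat.toComplex_neg a⟩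

theorem star_mem_gaussRing {c : ℂ} (hc : c ∈ gaussRing) : star c ∈ gaussRing := by
  obtain ⟨a, rfl⟩ := hc; exact ⟨a.conj, GaussRat.toComplex_conj a⟩

instance : StarRing gaussRing where
  star c := ⟨star c.1, star_mem_gaussRing c.2⟩
  star_involutive c := Subtype.ext (star_star c.1)
  star_mul a b := Subtype.ext (star_mul a.1 b.1)
  star_add a b := Subtype.ext (star_add a.1 b.1)

@[simp] theorem coe_star_gaussRing (c : gaussRing) : ((star c : gaussRing) : ℂ) = star (c : ℂ) := rfl

theorem denseRange_gaussRing : DenseRange ((↑) : gaussRing → ℂ) := by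
  have h1 : DenseRange (fun q : ℚ × ℚ => ((q.1 : ℝ), (q.2 : ℝ))) :=
    Rat.denseRange_cast.prodMap Rat.denseRange_cast
  have h2 : Function.Surjective (fun x : ℝ × ℝ => (x.1 : ℂ) + x.2 * Complex.I) :=
    fun z => ⟨(z.re, z.im), Complex.re_add_im z⟩
  have h3 := h2.denseRange.comp h1 (by fun_prop)
  refine h3.mono ?_
  rintro _ ⟨⟨a, b⟩, rfl⟩
  refine ⟨⟨_, ((a.num * b.den, b.num * a.den), a.den * b.den - 1), rfl⟩, ?_⟩
  have ha : (a.den : ℂ) ≠ 0 := by exact_mod_cast a.den_ne_zero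
  have hb : (b.den : ℂ) ≠ 0 := by exact_mod_cast b.den_ne_zero
  have hab : 1 ≤ a.den * b.den := Nat.mul_pos a.den_pos b.den_pos
  have ea : ((a : ℝ) : ℂ) = a.num / a.den := by
    conv_lhs => rw [← Rat.num_div_den a]
    push_cast; rfl
  have eb : ((b : ℝ) : ℂ) = b.num / b.den := by
    conv_lhs => rw [← Rat.num_div_den b]
    push_cast; rfl
  simp only [GaussRat.toComplex, Function.comp, ea, eb]
  rw [Nat.cast_sub hab]
  push_cast
  field_simp
  ring

/-! ### Completing a C*-seminormed `*`-ring over `ℚ(i)` to a complex C*-algebra. -/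

section Completion

variable {R : Type u} [SeminormedRing R] [StarRing R]

/-- The calculus only sees coefficients in `ℚ(i)`, while universality of `A` speaks of complex
C*-algebras. The Hausdorff completion bridges the gap: `κ` is contractive and `ℚ(i)` is dense in
`ℂ`, so the scalars extend by continuity, and all identities pass to the limit. -/
theorem exists_cstarAlgebra_completion (κ : gaussRing →+* R)
    (hκ : ∀ c, ‖κ c‖ ≤ ‖(c : ℂ)‖) (hκs : ∀ c, κ (star c) = star (κ c))
    (hκc : ∀ c a, Commute (κ c) a) (hC : ∀ a : R, ‖a‖ * ‖a‖ ≤ ‖star a * a‖) :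
    ∃ (C : Type u) (_ : CStarAlgebra C) (ι : R →+* C),
      (∀ a, ‖ι a‖ = ‖a‖) ∧ (∀ a, ι (star a) = star (ι a)) ∧
        ∀ c : gaussRing, ι (κ c) = algebraMap ℂ C (c : ℂ) := by
  -- The involution is isometric because `‖a*‖² ≤ ‖a a*‖ ≤ ‖a‖ ‖a*‖`.
  have hstar_le (a : R) : ‖star a‖ ≤ ‖a‖ := by
    have h := (hC (star a)).trans (norm_mul_le _ _)
    rw [star_star] at h
    by_contra! hlt
    nlinarith [norm_nonneg a]
  have hstar : ∀ a : R, ‖star a‖ = ‖a‖ := fun a =>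
    le_antisymm (hstar_le a) (by simpa using hstar_le (star a))
  let C := Completion R
  have hsu : UniformContinuous (star : R → R) :=
    (AddMonoidHomClass.isometry_of_norm (starAddEquiv : R ≃+ R) hstar).uniformContinuous
  have hmul (x y : C) : Completion.map star (x * y) = Completion.map star y * Completion.map star x := by
    induction x, y using Completion.induction_on₂ with
    | hp => apply isClosed_eq <;> fun_prop
    | ih a b =>
      rw [← Completion.coe_mul, Completion.map_coe hsu, Completion.map_coe hsu,
        Completion.map_coe hsu, star_mul, Completion.coe_mul]
  let : StarRing C :=
    { star := Completion.map star
      star_involutive := fun x => by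
        induction x using Completion.induction_on with
        | hp => apply isClosed_eq <;> fun_prop
        | ih a => rw [Completion.map_coe hsu, Completion.map_coe hsu, star_star]
      star_mul := hmul
      star_add := fun x y => by
        induction x, y using Completion.induction_on₂ with
        | hp => apply isClosed_eq <;> fun_prop
        | ih a b =>
          rw [← Completion.coe_add, Completion.map_coe hsu, Completion.map_coe hsu,
            Completion.map_coe hsu, star_add, Completion.coe_add] }
  have hsc : Continuous (star : C → C) := Completion.continuous_map
  have hcoe (a : R) : star (a : C) = ((star a : R) : C) := Completion.map_coe hsu a
  have : CStarRing C := ⟨fun x => by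
    induction x using Completion.induction_on with
    | hp => apply isClosed_le <;> fun_prop
    | ih a =>
      rw [hcoe, ← Completion.coe_mul, Completion.norm_coe, Completion.norm_coe]
      exact hC a⟩
  let f : gaussRing →+* C := (Completion.coeRingHom : R →+* C).comp κ
  have hf (c : gaussRing) : f c = ((κ c : R) : C) := rfl
  have hfu : UniformContinuous f :=
    AddMonoidHomClass.uniformContinuous_of_bound f 1 fun c => by
      rw [hf, Completion.norm_coe, one_mul]; exact hκ c
  have ue : IsUniformInducing gaussRing.subtype := isUniformEmbedding_subtype_val.isUniformInducing
  have dr : DenseRange gaussRing.subtype := denseRange_gaussRing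
  let g : ℂ →+* C := IsDenseInducing.extendRingHom ue dr hfu
  have hg (c : gaussRing) : g c = f c :=
    (ue.isDenseInducing dr).extend_eq hfu.continuous c
  have hgc : Continuous g := (uniformContinuous_uniformly_extend ue dr hfu).continuous
  have hgn (c : ℂ) : ‖g c‖ ≤ ‖c‖ := by
    induction c using denseRange_gaussRing.induction_on with
    | hp => apply isClosed_le <;> fun_prop
    | ih c => rw [hg, hf, Completion.norm_coe]; exact hκ c
  have hgs (c : ℂ) : g (star c) = star (g c) := by
    induction c using denseRange_gaussRing.induction_on with
    | hp => apply isClosed_eq <;> fun_prop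
    | ih c => rw [← coe_star_gaussRing, hg, hg, hf, hf, hcoe, hκs]
  have hgm (c : ℂ) (x : C) : g c * x = x * g c := by
    induction c using denseRange_gaussRing.induction_on with
    | hp => apply isClosed_eq <;> fun_prop
    | ih c =>
      induction x using Completion.induction_on with
      | hp => apply isClosed_eq <;> fun_prop
      | ih a => rw [hg, hf, ← Completion.coe_mul, ← Completion.coe_mul, (hκc c a).eq]
  let alg : Algebra ℂ C := g.toAlgebra' hgm
  let : NormedAlgebra ℂ C :=
    { alg with
      norm_smul_le := fun c x => by
        rw [Algebra.smul_def]
        exact (norm_mul_le _ _).trans (mul_le_mul_of_nonneg_right (hgn c) (norm_nonneg x)) }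
  have : StarModule ℂ C := ⟨fun c x => by
    rw [Algebra.smul_def, Algebra.smul_def, star_mul]
    exact (congrArg (star x * ·) (hgs c).symm).trans (hgm _ _).symm⟩
  exact ⟨C, { }, Completion.coeRingHom, Completion.norm_coe, fun a => (hcoe a).symm,
    fun c => (hg c).symm⟩

end Completion
end FinCStar

namespace FinCStar

/-! ### Primitive recursiveness of integer and Gaussian rational arithmetic. -/

section PrimrecInt

theorem encode_int_ofNat (n : ℕ) : Encodable.encode (n : ℤ) = 2 * n := rfl
theorem encode_int_negSucc (n : ℕ) : Encodable.encode (Int.negSucc n) = 2 * n + 1 := rfl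

theorem primrec_int_natCast : Primrec (fun n : ℕ => (n : ℤ)) :=
  Primrec.encode_iff.1 Primrec.nat_double

theorem primrec_int_toNat : Primrec Int.toNat := by
  refine (Primrec.ite (Primrec.eq.comp (Primrec.nat_mod.comp Primrec.encode (Primrec.const 2))
    (Primrec.const 0)) (Primrec.nat_div.comp Primrec.encode (Primrec.const 2))
    (Primrec.const 0)).of_eq fun z => ?_
  rcases z with n | n
  · simp [encode_int_ofNat]
  · simp [encode_int_negSucc]

theorem primrec_int_negPart : Primrec (fun z : ℤ => (-z).toNat) := by
  refine (Primrec.ite (Primrec.eq.comp (Primrec.nat_mod.comp Primrec.encode (Primrec.const 2))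
    (Primrec.const 0)) (Primrec.const 0)
    (Primrec.succ.comp (Primrec.nat_div.comp Primrec.encode (Primrec.const 2)))).of_eq fun z => ?_
  rcases z with n | n
  · simp [encode_int_ofNat]
  · simp [encode_int_negSucc, Nat.mul_add_div, Int.neg_negSucc]

/-- Integer operations reduce to this one: each integer is the difference of its positive and
negative parts, on which only natural number arithmetic is needed. -/
theorem primrec_int_natSub : Primrec₂ (fun a b : ℕ => (a : ℤ) - b) := by
  refine Primrec₂.encode_iff.1 ?_
  refine ((Primrec.ite (Primrec.nat_le.comp Primrec.snd Primrec.fst)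
    (Primrec.nat_double.comp (Primrec.nat_sub.comp Primrec.fst Primrec.snd))
    (Primrec.nat_double_succ.comp (Primrec.pred.comp
      (Primrec.nat_sub.comp Primrec.snd Primrec.fst)))).to₂ : Primrec₂ (fun a b : ℕ => _)).of_eq
    fun a b => ?_
  dsimp only
  split_ifs with h
  · rw [← Int.ofNat_sub h, encode_int_ofNat]
  · have : (a : ℤ) - b = Int.negSucc (b - a).pred := by
      rw [Int.negSucc_eq]; simp only [Nat.pred_eq_sub_one]; omega
    rw [this, encode_int_negSucc]

theorem primrec_int_add : Primrec₂ (fun a b : ℤ => a + b) := by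
  have p := primrec_int_toNat
  have m := primrec_int_negPart
  refine ((primrec_int_natSub.comp
    (Primrec.nat_add.comp (p.comp Primrec.fst) (p.comp Primrec.snd))
    (Primrec.nat_add.comp (m.comp Primrec.fst) (m.comp Primrec.snd))).to₂ :
      Primrec₂ (fun a b : ℤ => _)).of_eq fun a b => ?_
  dsimp only; omega

theorem primrec_int_neg : Primrec (fun a : ℤ => -a) := by
  refine (primrec_int_natSub.comp primrec_int_negPart primrec_int_toNat).of_eq fun a => ?_
  omega

theorem primrec_int_natAbs : Primrec Int.natAbs := by
  refine (Primrec.nat_add.comp primrec_int_negPart primrec_int_toNat).of_eq fun a => ?_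
  omega

theorem primrec_int_mul : Primrec₂ (fun a b : ℤ => a * b) := by
  have p := primrec_int_toNat
  have m := primrec_int_negPart
  have h {f g : ℤ → ℕ} (hf : Primrec f) (hg : Primrec g) :
      Primrec (fun x : ℤ × ℤ => f x.1 * g x.2) :=
    Primrec.nat_mul.comp (hf.comp Primrec.fst) (hg.comp Primrec.snd)
  refine ((primrec_int_natSub.comp
    (Primrec.nat_add.comp (h p p) (h m m)) (Primrec.nat_add.comp (h p m) (h m p))).to₂ :
      Primrec₂ (fun a b : ℤ => _)).of_eq fun a b => ?_
  dsimp only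
  have e (z : ℤ) : z = z.toNat - (-z).toNat := by omega
  conv_rhs => rw [e a, e b]
  push_cast
  ring

end PrimrecInt

section PrimrecGaussRat

theorem primrec_nat_mul_add_add : Primrec₂ (fun a b : ℕ => a * b + a + b) :=
  Primrec.nat_add.comp (Primrec.nat_add.comp Primrec.nat_mul Primrec.fst) Primrec.snd

theorem GaussRat.primrec_add : Primrec₂ GaussRat.add := by
  have r1 : Primrec (fun x : GaussRat × GaussRat => x.1.1.1) :=
    Primrec.fst.comp (Primrec.fst.comp Primrec.fst)
  have i1 : Primrec (fun x : GaussRat × GaussRat => x.1.1.2) :=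
    Primrec.snd.comp (Primrec.fst.comp Primrec.fst)
  have r2 : Primrec (fun x : GaussRat × GaussRat => x.2.1.1) :=
    Primrec.fst.comp (Primrec.fst.comp Primrec.snd)
  have i2 : Primrec (fun x : GaussRat × GaussRat => x.2.1.2) :=
    Primrec.snd.comp (Primrec.fst.comp Primrec.snd)
  have d1 : Primrec (fun x : GaussRat × GaussRat => x.1.2) := Primrec.snd.comp Primrec.fst
  have d2 : Primrec (fun x : GaussRat × GaussRat => x.2.2) := Primrec.snd.comp Primrec.snd
  have s1 := primrec_int_natCast.comp (Primrec.succ.comp d1)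
  have s2 := primrec_int_natCast.comp (Primrec.succ.comp d2)
  exact ((primrec_int_add.comp (primrec_int_mul.comp r1 s2) (primrec_int_mul.comp r2 s1)).pair
    (primrec_int_add.comp (primrec_int_mul.comp i1 s2) (primrec_int_mul.comp i2 s1))).pair
    (primrec_nat_mul_add_add.comp d1 d2)

theorem GaussRat.primrec_mul : Primrec₂ GaussRat.mul := by
  have r1 : Primrec (fun x : GaussRat × GaussRat => x.1.1.1) :=
    Primrec.fst.comp (Primrec.fst.comp Primrec.fst)
  have i1 : Primrec (fun x : GaussRat × GaussRat => x.1.1.2) :=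
    Primrec.snd.comp (Primrec.fst.comp Primrec.fst)
  have r2 : Primrec (fun x : GaussRat × GaussRat => x.2.1.1) :=
    Primrec.fst.comp (Primrec.fst.comp Primrec.snd)
  have i2 : Primrec (fun x : GaussRat × GaussRat => x.2.1.2) :=
    Primrec.snd.comp (Primrec.fst.comp Primrec.snd)
  have d1 : Primrec (fun x : GaussRat × GaussRat => x.1.2) := Primrec.snd.comp Primrec.fst
  have d2 : Primrec (fun x : GaussRat × GaussRat => x.2.2) := Primrec.snd.comp Primrec.snd
  exact ((primrec_int_add.comp (primrec_int_mul.comp r1 r2)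
      (primrec_int_neg.comp (primrec_int_mul.comp i1 i2))).pair
    (primrec_int_add.comp (primrec_int_mul.comp r1 i2) (primrec_int_mul.comp i1 r2))).pair
    (primrec_nat_mul_add_add.comp d1 d2)

theorem GaussRat.primrec_neg : Primrec GaussRat.neg :=
  ((primrec_int_neg.comp (Primrec.fst.comp Primrec.fst)).pair
    (primrec_int_neg.comp (Primrec.snd.comp Primrec.fst))).pair Primrec.snd

theorem GaussRat.primrec_conj : Primrec GaussRat.conj :=
  ((Primrec.fst.comp Primrec.fst).pair
    (primrec_int_neg.comp (Primrec.snd.comp Primrec.fst))).pair Primrec.snd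

end PrimrecGaussRat

/-! ### Nonnegative rationals as codes for norm bounds. -/

/-- A code `(a, b)` for the nonnegative rational `a / (b + 1)`. -/
abbrev BoundCode : Type := ℕ × ℕ

namespace BoundCode

/-- the real number named by a code -/
noncomputable def val (r : BoundCode) : ℝ := r.1 / (r.2 + 1)

/-- addition of codes -/
def add (r s : BoundCode) : BoundCode :=
  (r.1 * (s.2 + 1) + s.1 * (r.2 + 1), r.2 * s.2 + r.2 + s.2)

/-- multiplication of codes -/
def mul (r s : BoundCode) : BoundCode := (r.1 * s.1, r.2 * s.2 + r.2 + s.2)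

/-- comparison of codes -/
abbrev Le (r s : BoundCode) : Prop := r.1 * (s.2 + 1) ≤ s.1 * (r.2 + 1)

/-- the code of `2⁻ᵈ` -/
def twoPow (d : ℕ) : BoundCode := (1, 2 ^ d - 1)

/-- an upper bound for the modulus of a Gaussian rational -/
def abs (c : GaussRat) : BoundCode := (c.1.1.natAbs + c.1.2.natAbs, c.2)

theorem val_nonneg (r : BoundCode) : 0 ≤ r.val := by unfold val; positivity

theorem val_add (r s : BoundCode) : (r.add s).val = r.val + s.val := by
  have h (n : ℕ) : (n : ℝ) + 1 ≠ 0 := Nat.cast_add_one_ne_zero n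
  have e : ((r.2 * s.2 + r.2 + s.2 : ℕ) : ℝ) + 1 = (r.2 + 1) * (s.2 + 1) := by push_cast; ring
  simp only [val, add, e]
  have := h r.2
  have := h s.2
  push_cast
  field_simp

theorem val_mul (r s : BoundCode) : (r.mul s).val = r.val * s.val := by
  have h (n : ℕ) : (n : ℝ) + 1 ≠ 0 := Nat.cast_add_one_ne_zero n
  have e : ((r.2 * s.2 + r.2 + s.2 : ℕ) : ℝ) + 1 = (r.2 + 1) * (s.2 + 1) := by push_cast; ring
  simp only [val, mul, e]
  have := h r.2
  have := h s.2
  push_cast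
  field_simp

theorem le_iff (r s : BoundCode) : r.Le s ↔ r.val ≤ s.val := by
  have h (n : ℕ) : (0 : ℝ) < (n : ℝ) + 1 := Nat.cast_add_one_pos n
  rw [val, val, div_le_div_iff₀ (h _) (h _)]
  exact_mod_cast Iff.rfl

theorem val_twoPow (d : ℕ) : (twoPow d).val = (1 / 2 : ℝ) ^ d := by
  simp [val, twoPow, Nat.cast_sub Nat.one_le_two_pow]

theorem val_zero : val (0, 0) = 0 := by simp [val]

theorem norm_toComplex_le (c : GaussRat) : ‖c.toComplex‖ ≤ (abs c).val := by
  have h : ‖(c.2 : ℂ) + 1‖ = c.2 + 1 := by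
    rw [show (c.2 : ℂ) + 1 = ((c.2 + 1 : ℕ) : ℂ) by push_cast; rfl, Complex.norm_natCast]
    push_cast; rfl
  rw [GaussRat.toComplex, norm_div, h, val, abs]
  gcongr
  refine (norm_add_le _ _).trans ?_
  simp [Nat.cast_natAbs]

theorem exists_val_between {a b : ℝ} (ha : 0 ≤ a) (hab : a < b) :
    ∃ r : BoundCode, a < r.val ∧ r.val < b := by
  obtain ⟨q, h1, h2⟩ := exists_rat_btwn hab
  have hq : 0 < q := by exact_mod_cast ha.trans_lt h1
  have e : val (q.num.toNat, q.den - 1) = q := by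
    have h3 : ((q.num.toNat : ℕ) : ℤ) = q.num := Int.toNat_of_nonneg (Rat.num_pos.2 hq).le
    have h4 : ((q.num.toNat : ℕ) : ℝ) = q.num := by exact_mod_cast h3
    rw [val, h4, Nat.cast_sub q.den_pos]
    conv_rhs => rw [← Rat.num_div_den q]
    simp
  exact ⟨_, e ▸ h1, e ▸ h2⟩

theorem exists_val_eq_dyadic (a b : ℕ) : ∃ r : BoundCode, r.val = (a : ℝ) / 2 ^ b :=
  ⟨(a, 2 ^ b - 1), by simp [val, Nat.cast_sub Nat.one_le_two_pow]⟩

theorem primrec_add : Primrec₂ add := by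
  have a1 : Primrec (fun x : BoundCode × BoundCode => x.1.1) := Primrec.fst.comp Primrec.fst
  have b1 : Primrec (fun x : BoundCode × BoundCode => x.1.2) := Primrec.snd.comp Primrec.fst
  have a2 : Primrec (fun x : BoundCode × BoundCode => x.2.1) := Primrec.fst.comp Primrec.snd
  have b2 : Primrec (fun x : BoundCode × BoundCode => x.2.2) := Primrec.snd.comp Primrec.snd
  exact (Primrec.nat_add.comp (Primrec.nat_mul.comp a1 (Primrec.succ.comp b2))
    (Primrec.nat_mul.comp a2 (Primrec.succ.comp b1))).pair (primrec_nat_mul_add_add.comp b1 b2)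

theorem primrec_mul : Primrec₂ mul := by
  have a1 : Primrec (fun x : BoundCode × BoundCode => x.1.1) := Primrec.fst.comp Primrec.fst
  have b1 : Primrec (fun x : BoundCode × BoundCode => x.1.2) := Primrec.snd.comp Primrec.fst
  have a2 : Primrec (fun x : BoundCode × BoundCode => x.2.1) := Primrec.fst.comp Primrec.snd
  have b2 : Primrec (fun x : BoundCode × BoundCode => x.2.2) := Primrec.snd.comp Primrec.snd
  exact (Primrec.nat_mul.comp a1 a2).pair (primrec_nat_mul_add_add.comp b1 b2)

theorem primrec_le : PrimrecRel Le := by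
  have a1 : Primrec (fun x : BoundCode × BoundCode => x.1.1) := Primrec.fst.comp Primrec.fst
  have b1 : Primrec (fun x : BoundCode × BoundCode => x.1.2) := Primrec.snd.comp Primrec.fst
  have a2 : Primrec (fun x : BoundCode × BoundCode => x.2.1) := Primrec.fst.comp Primrec.snd
  have b2 : Primrec (fun x : BoundCode × BoundCode => x.2.2) := Primrec.snd.comp Primrec.snd
  exact Primrec.nat_le.comp (Primrec.nat_mul.comp a1 (Primrec.succ.comp b2))
    (Primrec.nat_mul.comp a2 (Primrec.succ.comp b1))

theorem primrec_nat_pow : Primrec₂ (fun a b : ℕ => a ^ b) :=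
  Primrec₂.unpaired'.1 Nat.Primrec.pow

theorem primrec_twoPow : Primrec twoPow :=
  (Primrec.const 1).pair (Primrec.pred.comp (primrec_nat_pow.comp (Primrec.const 2) Primrec.id))

theorem primrec_abs : Primrec abs :=
  (Primrec.nat_add.comp (primrec_int_natAbs.comp (Primrec.fst.comp Primrec.fst))
    (primrec_int_natAbs.comp (Primrec.snd.comp Primrec.fst))).pair Primrec.snd

end BoundCode

/-! ### Operations on rational `*`-polynomials as primitive recursive functions on lists. -/

namespace RatStarPoly

variable {n m : ℕ}

/-- product of rational `*`-polynomials -/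
def mul (p q : RatStarPoly n) : RatStarPoly n :=
  p.flatMap fun s => q.map fun t => (s.1.mul t.1, s.2 ++ t.2)

/-- adjoint of a word -/
def starWord (w : StarWord n) : StarWord n := (w.map fun g => (g.1, !g.2)).reverse

/-- adjoint of a rational `*`-polynomial -/
def adj (p : RatStarPoly n) : RatStarPoly n := p.map fun t => (t.1.conj, starWord t.2)

/-- negative of a rational `*`-polynomial -/
def neg (p : RatStarPoly n) : RatStarPoly n := p.map fun t => (t.1.neg, t.2)

/-- the coefficient of a word -/
def coef (p : RatStarPoly n) (w : StarWord n) : GaussRat :=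
  p.foldr (fun t c => if t.2 = w then t.1.add c else c) GaussRat.zero

/-- the polynomial is zero in the free `*`-algebra -/
abbrev IsZero (p : RatStarPoly n) : Prop := ∀ t ∈ p, (coef p t.2).1 = (0, 0)

/-- a letter as a polynomial -/
def letter (g : Fin n × Bool) : RatStarPoly n := [(GaussRat.one, [g])]

/-- the value of a letter at a tuple of polynomials -/
def substLetter (q : Fin m → RatStarPoly n) (g : Fin m × Bool) : RatStarPoly n :=
  if g.2 = true then adj (q g.1) else q g.1

/-- the value of a word at a tuple of polynomials -/
def substWord (q : Fin m → RatStarPoly n) (w : StarWord m) : RatStarPoly n :=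
  w.foldr (fun g r => mul (substLetter q g) r) [(GaussRat.one, [])]

/-- composition of a rational `*`-polynomial with a tuple of polynomials -/
def subst (q : Fin m → RatStarPoly n) (p : RatStarPoly m) : RatStarPoly n :=
  p.flatMap fun t => mul [(t.1, [])] (substWord q t.2)

theorem primrec_mul : Primrec₂ (mul : RatStarPoly n → RatStarPoly n → RatStarPoly n) := by
  refine Primrec.list_flatMap Primrec.fst ?_
  refine Primrec.list_map (Primrec.snd.comp Primrec.fst) ?_
  have s : Primrec (fun x : ((RatStarPoly n × RatStarPoly n) × (GaussRat × StarWord n)) ×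
      (GaussRat × StarWord n) => x.1.2) := Primrec.snd.comp Primrec.fst
  exact (GaussRat.primrec_mul.comp (Primrec.fst.comp s) (Primrec.fst.comp Primrec.snd)).pair
    (Primrec.list_append.comp (Primrec.snd.comp s) (Primrec.snd.comp Primrec.snd))

theorem primrec_adj : Primrec (adj : RatStarPoly n → RatStarPoly n) := by
  refine Primrec.list_map Primrec.id ?_
  have hw : Primrec (starWord : StarWord n → StarWord n) :=
    Primrec.list_reverse.comp (Primrec.list_map Primrec.id
      ((Primrec.fst.comp Primrec.snd).pair (Primrec.not.comp (Primrec.snd.comp Primrec.snd))))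
  exact (GaussRat.primrec_conj.comp (Primrec.fst.comp Primrec.snd)).pair
    (hw.comp (Primrec.snd.comp Primrec.snd))

theorem primrec_neg : Primrec (neg : RatStarPoly n → RatStarPoly n) :=
  Primrec.list_map Primrec.id
    ((GaussRat.primrec_neg.comp (Primrec.fst.comp Primrec.snd)).pair (Primrec.snd.comp Primrec.snd))

theorem primrec_coef : Primrec₂ (coef : RatStarPoly n → StarWord n → GaussRat) := by
  refine Primrec.list_foldr (α := RatStarPoly n × StarWord n)
    (h := fun a x => if x.1.2 = a.2 then x.1.1.add x.2 else x.2) Primrec.fst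
    (Primrec.const GaussRat.zero) ?_
  have t : Primrec (fun x : (RatStarPoly n × StarWord n) × ((GaussRat × StarWord n) × GaussRat) =>
      x.2.1) := Primrec.fst.comp Primrec.snd
  have c : Primrec (fun x : (RatStarPoly n × StarWord n) × ((GaussRat × StarWord n) × GaussRat) =>
      x.2.2) := Primrec.snd.comp Primrec.snd
  exact Primrec.ite (Primrec.eq.comp (Primrec.snd.comp t) (Primrec.snd.comp Primrec.fst))
    (GaussRat.primrec_add.comp (Primrec.fst.comp t) c) c

theorem primrec_isZero : PrimrecPred (IsZero : RatStarPoly n → Prop) := by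
  have h : PrimrecRel (fun (t : GaussRat × StarWord n) (p : RatStarPoly n) =>
      (coef p t.2).1 = (0, 0)) :=
    Primrec.eq.comp (Primrec.fst.comp (primrec_coef.comp Primrec.snd
      (Primrec.snd.comp Primrec.fst))) (Primrec.const _)
  exact h.forall_mem_list.comp (Primrec.id (α := RatStarPoly n)) Primrec.id

theorem primrec_substLetter : Primrec₂ (substLetter : (Fin m → RatStarPoly n) → _ → _) := by
  have h : Primrec (fun x : (Fin m → RatStarPoly n) × (Fin m × Bool) => x.1 x.2.1) :=
    Primrec.fin_app.comp Primrec.fst (Primrec.fst.comp Primrec.snd)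
  exact Primrec.ite (Primrec.eq.comp (Primrec.snd.comp Primrec.snd) (Primrec.const true))
    (primrec_adj.comp h) h

theorem primrec_substWord : Primrec₂ (substWord : (Fin m → RatStarPoly n) → _ → _) := by
  refine Primrec.list_foldr (α := (Fin m → RatStarPoly n) × StarWord m)
    (h := fun a x => mul (substLetter a.1 x.1) x.2) Primrec.snd
    (Primrec.const ([(GaussRat.one, [])] : RatStarPoly n)) ?_
  exact primrec_mul.comp (primrec_substLetter.comp (Primrec.fst.comp Primrec.fst)
    (Primrec.fst.comp Primrec.snd)) (Primrec.snd.comp Primrec.snd)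

theorem primrec_subst : Primrec₂ (subst : (Fin m → RatStarPoly n) → _ → _) := by
  refine Primrec.list_flatMap (α := (Fin m → RatStarPoly n) × RatStarPoly m) Primrec.snd ?_
  have t : Primrec (fun x : ((Fin m → RatStarPoly n) × RatStarPoly m) × (GaussRat × StarWord m) =>
      x.2) := Primrec.snd
  exact primrec_mul.comp
    (Primrec.list_cons.comp ((Primrec.fst.comp t).pair (Primrec.const [])) (Primrec.const []))
    (primrec_substWord.comp (Primrec.fst.comp Primrec.fst) (Primrec.snd.comp t))

end RatStarPoly
end FinCStar

namespace FinCStar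

/-- a code of a Gaussian rational, as an element of the ring of Gaussian rationals -/
noncomputable def GaussRat.toRing (c : GaussRat) : gaussRing := ⟨c.toComplex, c, rfl⟩

namespace GaussRat

theorem toRing_zero : toRing zero = 0 := Subtype.ext toComplex_zero
theorem toRing_one : toRing one = 1 := Subtype.ext toComplex_one
theorem toRing_add (c d : GaussRat) : toRing (c.add d) = toRing c + toRing d :=
  Subtype.ext (toComplex_add c d)
theorem toRing_mul (c d : GaussRat) : toRing (c.mul d) = toRing c * toRing d :=
  Subtype.ext (toComplex_mul c d)
theorem toRing_neg (c : GaussRat) : toRing c.neg = -toRing c := Subtype.ext (toComplex_neg c)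
theorem toRing_conj (c : GaussRat) : toRing c.conj = star (toRing c) :=
  Subtype.ext (toComplex_conj c)

theorem toRing_surjective : Function.Surjective toRing := by
  rintro ⟨_, c, rfl⟩; exact ⟨c, rfl⟩

theorem toRing_eq_zero_iff (c : GaussRat) : toRing c = 0 ↔ c.1 = (0, 0) := by
  rw [← toComplex_eq_zero_iff, ← Subtype.coe_inj]; rfl

end GaussRat

namespace RatStarPoly

/-! ### Evaluation of polynomials in `*`-rings over `ℚ(i)`. -/

section RingEval

variable {n m : ℕ} {S : Type v} [Ring S] [StarRing S]

/-- the value of a letter at a tuple in a `*`-ring -/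
def ringLetter (v : Fin n → S) (g : Fin n × Bool) : S := if g.2 then star (v g.1) else v g.1

/-- the value of a word at a tuple in a `*`-ring -/
def ringWord (v : Fin n → S) (w : StarWord n) : S := (w.map (ringLetter v)).prod

/-- the value of a rational `*`-polynomial at a tuple in a `*`-ring over `ℚ(i)` -/
noncomputable def ringEval (κ : gaussRing →+* S) (v : Fin n → S) (p : RatStarPoly n) : S :=
  (p.map fun t => κ t.1.toRing * ringWord v t.2).sum

variable (κ : gaussRing →+* S) (v : Fin n → S)

@[simp] theorem ringEval_nil : ringEval κ v [] = 0 := rfl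

@[simp] theorem ringEval_cons (t : GaussRat × StarWord n) (p : RatStarPoly n) :
    ringEval κ v (t :: p) = κ t.1.toRing * ringWord v t.2 + ringEval κ v p := by
  simp [ringEval]

theorem ringEval_append (p q : RatStarPoly n) :
    ringEval κ v (p ++ q) = ringEval κ v p + ringEval κ v q := by
  simp [ringEval]

theorem ringEval_neg (p : RatStarPoly n) : ringEval κ v (neg p) = -ringEval κ v p := by
  induction p with
  | nil => simp [neg]
  | cons t p ih =>
    have e : neg (t :: p) = (t.1.neg, t.2) :: neg p := rfl
    rw [e, ringEval_cons, ih, ringEval_cons, GaussRat.toRing_neg, map_neg]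
    noncomm_ring

theorem ringWord_append (w w' : StarWord n) :
    ringWord v (w ++ w') = ringWord v w * ringWord v w' := by
  simp [ringWord]

theorem ringWord_starWord (w : StarWord n) : ringWord v (starWord w) = star (ringWord v w) := by
  induction w with
  | nil => simp [ringWord, starWord]
  | cons g w ih =>
    have e : starWord (g :: w) = starWord w ++ [(g.1, !g.2)] := by simp [starWord]
    rw [e, ringWord_append, ih]
    rcases g with ⟨k, _ | _⟩ <;> simp [ringWord, ringLetter]

theorem ringEval_single (c : GaussRat) : ringEval κ v [(c, [])] = κ c.toRing := by
  simp [ringWord]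

theorem ringEval_letter (g : Fin n × Bool) : ringEval κ v (letter g) = ringLetter v g := by
  simp [letter, ringWord, GaussRat.toRing_one]

theorem ringEval_adj (hs : ∀ c, κ (star c) = star (κ c)) (hc : ∀ c a, Commute (κ c) a)
    (p : RatStarPoly n) : ringEval κ v (adj p) = star (ringEval κ v p) := by
  induction p with
  | nil => simp [adj]
  | cons t p ih =>
    have e : adj (t :: p) = (t.1.conj, starWord t.2) :: adj p := rfl
    rw [e, ringEval_cons, ih, ringEval_cons, star_add, star_mul, ringWord_starWord,
      GaussRat.toRing_conj, hs, ← hs, (hc _ _).eq]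

theorem ringEval_mul (hc : ∀ c a, Commute (κ c) a) (p q : RatStarPoly n) :
    ringEval κ v (mul p q) = ringEval κ v p * ringEval κ v q := by
  have h (t : GaussRat × StarWord n) : ringEval κ v (q.map fun s => (t.1.mul s.1, t.2 ++ s.2)) =
      κ t.1.toRing * ringWord v t.2 * ringEval κ v q := by
    induction q with
    | nil => simp
    | cons s q ih =>
      rw [List.map_cons, ringEval_cons, ih, ringEval_cons, GaussRat.toRing_mul, map_mul,
        ringWord_append, mul_add]
      congr 1
      rw [mul_assoc, mul_assoc, ← mul_assoc (ringWord v t.2), ← (hc s.1.toRing (ringWord v t.2)).eq,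
        mul_assoc]
  induction p with
  | nil => simp [mul]
  | cons t p ih =>
    have e : mul (t :: p) q = (q.map fun s => (t.1.mul s.1, t.2 ++ s.2)) ++ mul p q := rfl
    rw [e, ringEval_append, ih, h, ringEval_cons, add_mul]

theorem ringEval_subst (hs : ∀ c, κ (star c) = star (κ c)) (hc : ∀ c a, Commute (κ c) a)
    (q : Fin m → RatStarPoly n) (p : RatStarPoly m) :
    ringEval κ v (subst q p) = ringEval κ (fun k => ringEval κ v (q k)) p := by
  have hl (g : Fin m × Bool) : ringEval κ v (substLetter q g) =
      ringLetter (fun k => ringEval κ v (q k)) g := by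
    rcases g with ⟨k, _ | _⟩ <;> simp [substLetter, ringLetter, ringEval_adj κ v hs hc]
  have hw (w : StarWord m) : ringEval κ v (substWord q w) =
      ringWord (fun k => ringEval κ v (q k)) w := by
    induction w with
    | nil => simp [substWord, ringWord, GaussRat.toRing_one]
    | cons g w ih =>
      have e : substWord q (g :: w) = mul (substLetter q g) (substWord q w) := rfl
      rw [e, ringEval_mul κ v hc, ih, hl]
      simp [ringWord]
  induction p with
  | nil => simp [subst]
  | cons t p ih =>
    have e : subst q (t :: p) = mul [(t.1, [])] (substWord q t.2) ++ subst q p := rfl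
    rw [e, ringEval_append, ih, ringEval_mul κ v hc, ringEval_single, hw, ringEval_cons]

end RingEval

/-! ### The free `*`-algebra over `ℚ(i)`, placed in the universe over which universality of `A`
quantifies. -/

section Free

variable {n : ℕ}

/-- The free `*`-algebra over `ℚ(i)`. -/
def FreeStar (n : ℕ) : Type u := MonoidAlgebra gaussRing (ULift.{u} (FreeMonoid (Fin n × Bool)))

noncomputable instance : Ring (FreeStar.{u} n) :=
  inferInstanceAs (Ring (MonoidAlgebra gaussRing (ULift.{u} (FreeMonoid (Fin n × Bool)))))

/-- a monomial of the free `*`-algebra -/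
noncomputable def FreeStar.monomial (w : StarWord n) (c : gaussRing) : FreeStar.{u} n :=
  MonoidAlgebra.single (ULift.up (FreeMonoid.ofList w)) c

theorem FreeStar.monomial_mul (w w' : StarWord n) (c c' : gaussRing) :
    (monomial w c : FreeStar.{u} n) * monomial w' c' = monomial (w ++ w') (c * c') :=
  MonoidAlgebra.single_mul_single _ _ _ _

theorem FreeStar.monomial_add (w : StarWord n) (c c' : gaussRing) :
    (monomial w (c + c') : FreeStar.{u} n) = monomial w c + monomial w c' :=
  MonoidAlgebra.single_add _ _ _

theorem FreeStar.monomial_zero (w : StarWord n) : (monomial w 0 : FreeStar.{u} n) = 0 :=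
  MonoidAlgebra.single_zero _

theorem FreeStar.induction {P : FreeStar.{u} n → Prop} (a : FreeStar.{u} n) (h0 : P 0)
    (hadd : ∀ a b, P a → P b → P (a + b)) (hm : ∀ w c, P (monomial w c)) : P a :=
  MonoidAlgebra.induction_linear (motive := P) a h0 hadd fun w c => hm w.down.toList c

/-- the additive map out of the free `*`-algebra with given values on monomials -/
noncomputable def FreeStar.lift {S : Type v} [Ring S] (κ : gaussRing →+ S) (f : StarWord n → S) :
    FreeStar.{u} n →+ S :=
  MonoidAlgebra.liftNC κ fun w => f w.down.toList

theorem FreeStar.lift_monomial {S : Type v} [Ring S] (κ : gaussRing →+ S) (f : StarWord n → S)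
    (w : StarWord n) (c : gaussRing) :
    lift κ f (monomial w c : FreeStar.{u} n) = κ c * f w :=
  MonoidAlgebra.liftNC_single _ _ _ _

/-- the scalars of the free `*`-algebra -/
noncomputable def FreeStar.scalar : gaussRing →+* FreeStar.{u} n where
  toFun := monomial []
  map_one' := rfl
  map_mul' c d := (monomial_mul [] [] c d).symm
  map_zero' := monomial_zero []
  map_add' := monomial_add []

theorem FreeStar.commute_scalar (c : gaussRing) (a : FreeStar.{u} n) : Commute (scalar c) a := by
  induction a using FreeStar.induction with
  | h0 => exact Commute.zero_right _
  | hadd a b ha hb => exact ha.add_right hb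
  | hm w d =>
    change monomial [] c * monomial w d = monomial w d * monomial [] c
    rw [monomial_mul, monomial_mul, mul_comm, List.append_nil, List.nil_append]

/-- the involution of the free `*`-algebra -/
noncomputable def FreeStar.starHom : FreeStar.{u} n →+ FreeStar.{u} n :=
  lift ((scalar : gaussRing →+* FreeStar.{u} n).toAddMonoidHom.comp
    (starAddEquiv : gaussRing ≃+ gaussRing).toAddMonoidHom) fun w => monomial (starWord w) 1

theorem FreeStar.starHom_monomial (w : StarWord n) (c : gaussRing) :
    starHom (monomial w c : FreeStar.{u} n) = monomial (starWord w) (star c) := by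
  rw [starHom, lift_monomial]
  change monomial [] (star c) * monomial (starWord w) 1 = _
  rw [monomial_mul, mul_one, List.nil_append]

theorem starWord_starWord (w : StarWord n) : starWord (starWord w) = w := by
  simp [starWord, Function.comp_def]

theorem starWord_append (w w' : StarWord n) :
    starWord (w ++ w') = starWord w' ++ starWord w := by
  simp [starWord]

noncomputable instance : StarRing (FreeStar.{u} n) where
  star := FreeStar.starHom
  star_involutive a := by
    induction a using FreeStar.induction with
    | h0 => simp
    | hadd a b ha hb => rw [map_add, map_add, ha, hb]
    | hm w c => rw [FreeStar.starHom_monomial, FreeStar.starHom_monomial, star_star,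
        starWord_starWord]
  star_mul a b := by
    change FreeStar.starHom (a * b) = FreeStar.starHom b * FreeStar.starHom a
    induction a using FreeStar.induction with
    | h0 => simp
    | hadd a a' ha ha' => rw [add_mul, map_add, map_add, mul_add, ha, ha']
    | hm w c =>
      induction b using FreeStar.induction with
      | h0 => simp
      | hadd b b' hb hb' => rw [mul_add, map_add, map_add, add_mul, hb, hb']
      | hm w' d =>
        rw [FreeStar.monomial_mul, FreeStar.starHom_monomial, FreeStar.starHom_monomial,
          FreeStar.starHom_monomial, FreeStar.monomial_mul, starWord_append, star_mul]
  star_add := map_add FreeStar.starHom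

theorem FreeStar.star_monomial (w : StarWord n) (c : gaussRing) :
    star (monomial w c : FreeStar.{u} n) = monomial (starWord w) (star c) :=
  starHom_monomial w c

theorem FreeStar.scalar_star (c : gaussRing) :
    (scalar (star c) : FreeStar.{u} n) = star (scalar c) :=
  (star_monomial [] c).symm

/-- the free generators -/
noncomputable def FreeStar.gen (k : Fin n) : FreeStar.{u} n := monomial [(k, false)] 1

theorem FreeStar.ringWord_gen (w : StarWord n) :
    ringWord (gen : Fin n → FreeStar.{u} n) w = monomial w 1 := by
  induction w with
  | nil => rfl
  | cons g w ih =>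
    have e : ringWord (gen : Fin n → FreeStar.{u} n) (g :: w) = ringLetter gen g * ringWord gen w := by
      simp [ringWord]
    have hg : ringLetter (gen : Fin n → FreeStar.{u} n) g = monomial [g] 1 := by
      rcases g with ⟨k, _ | _⟩
      · rfl
      · simp [ringLetter, gen, star_monomial, starWord]
    rw [e, ih, hg, monomial_mul, one_mul]; rfl

/-- the element of the free `*`-algebra named by a rational `*`-polynomial -/
noncomputable def toFree (p : RatStarPoly n) : FreeStar.{u} n :=
  ringEval FreeStar.scalar FreeStar.gen p

theorem toFree_nil : toFree ([] : RatStarPoly n) = (0 : FreeStar.{u} n) := rfl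

theorem toFree_cons (t : GaussRat × StarWord n) (p : RatStarPoly n) :
    (toFree (t :: p) : FreeStar.{u} n) = FreeStar.monomial t.2 t.1.toRing + toFree p := by
  rw [toFree, ringEval_cons, FreeStar.ringWord_gen]
  change FreeStar.monomial [] _ * _ + _ = _
  rw [FreeStar.monomial_mul, mul_one]; rfl

theorem toFree_surjective : Function.Surjective (toFree : RatStarPoly n → FreeStar.{u} n) := by
  intro a
  induction a using FreeStar.induction with
  | h0 => exact ⟨[], rfl⟩
  | hadd a b ha hb =>
    obtain ⟨p, rfl⟩ := ha
    obtain ⟨q, rfl⟩ := hb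
    exact ⟨p ++ q, ringEval_append _ _ p q⟩
  | hm w c =>
    obtain ⟨c, rfl⟩ := GaussRat.toRing_surjective c
    exact ⟨[(c, w)], by rw [toFree_cons, toFree_nil, add_zero]⟩

theorem coeff_toFree (p : RatStarPoly n) (w : StarWord n) :
    MonoidAlgebra.coeff (toFree p : FreeStar.{u} n) (ULift.up (FreeMonoid.ofList w)) =
      (coef p w).toRing := by
  classical
  induction p with
  | nil => exact GaussRat.toRing_zero.symm
  | cons t p ih =>
    have e : coef (t :: p) w = if t.2 = w then t.1.add (coef p w) else coef p w := rfl
    rw [toFree_cons]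
    change MonoidAlgebra.coeff (FreeStar.monomial t.2 t.1.toRing : FreeStar.{u} n) _ +
      MonoidAlgebra.coeff (toFree p : FreeStar.{u} n) _ = _
    rw [ih, e, FreeStar.monomial, MonoidAlgebra.coeff_single, Finsupp.single_apply]
    have h : (ULift.up (FreeMonoid.ofList t.2) : ULift.{u} (FreeMonoid (Fin n × Bool))) =
        ULift.up (FreeMonoid.ofList w) ↔ t.2 = w := by
      rw [ULift.up_inj]; exact FreeMonoid.ofList.injective.eq_iff
    by_cases hw : t.2 = w
    · rw [if_pos (h.2 hw), if_pos hw, GaussRat.toRing_add]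
    · rw [if_neg (mt h.1 hw), if_neg hw, zero_add]

/-- Testing the finitely many words that occur in `p` is enough, since every other word has
coefficient zero. -/
theorem isZero_iff (p : RatStarPoly n) : IsZero p ↔ (toFree p : FreeStar.{u} n) = 0 := by
  constructor
  · intro h
    refine MonoidAlgebra.ext (Finsupp.ext fun w => ?_)
    have e : w = ULift.up (FreeMonoid.ofList w.down.toList) := rfl
    rw [e, coeff_toFree]
    generalize w.down.toList = w
    change _ = (0 : gaussRing)
    by_cases hw : ∃ t ∈ p, t.2 = w
    · obtain ⟨t, ht, rfl⟩ := hw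
      exact (GaussRat.toRing_eq_zero_iff _).2 (h t ht)
    · have : coef p w = GaussRat.zero := by
        clear h
        induction p with
        | nil => rfl
        | cons t p ih =>
          have e : coef (t :: p) w = if t.2 = w then t.1.add (coef p w) else coef p w := rfl
          simp only [List.mem_cons, exists_eq_or_imp, not_or] at hw
          rw [e, if_neg hw.1, ih hw.2]
      rw [this, GaussRat.toRing_zero]
  · intro h t _
    rw [← GaussRat.toRing_eq_zero_iff, ← coeff_toFree.{u}, h]
    rfl

theorem ringEval_eq_lift {S : Type v} [Ring S] [StarRing S] (κ : gaussRing →+* S) (v : Fin n → S)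
    (p : RatStarPoly n) :
    ringEval κ v p = FreeStar.lift κ.toAddMonoidHom (ringWord v) (toFree p : FreeStar.{u} n) := by
  induction p with
  | nil => rw [toFree_nil, map_zero, ringEval_nil]
  | cons t p ih =>
    rw [toFree_cons, map_add, FreeStar.lift_monomial, ← ih, ringEval_cons]; rfl

theorem ringEval_eq_of_isZero {S : Type v} [Ring S] [StarRing S] (κ : gaussRing →+* S)
    (v : Fin n → S) {p q : RatStarPoly n} (h : IsZero (p ++ neg q)) :
    ringEval κ v p = ringEval κ v q := by
  rw [← sub_eq_zero, sub_eq_add_neg, ← ringEval_neg, ← ringEval_append, ringEval_eq_lift.{0},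
    (isZero_iff _).1 h, map_zero]

theorem isZero_append_neg_iff {p q : RatStarPoly n} :
    IsZero (p ++ neg q) ↔ (toFree p : FreeStar.{u} n) = toFree q := by
  rw [isZero_iff.{u}, toFree, ringEval_append, ringEval_neg, ← sub_eq_add_neg, sub_eq_zero]; rfl

end Free

/-! ### Evaluation of polynomials in C*-algebras. -/

section PolyEval

variable {n m : ℕ} {B : Type v} [CStarAlgebra B]

/-- the scalars `ℚ(i)` of a C*-algebra -/
noncomputable def gaussScalar (B : Type v) [CStarAlgebra B] : gaussRing →+* B :=
  (algebraMap ℂ B).comp gaussRing.subtype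

theorem gaussScalar_star (c : gaussRing) : gaussScalar B (star c) = star (gaussScalar B c) :=
  algebraMap_star_comm (c : ℂ)

theorem gaussScalar_commute (c : gaussRing) (a : B) : Commute (gaussScalar B c) a :=
  Algebra.commutes (c : ℂ) a

theorem polyEval_eq_ringEval (p : RatStarPoly n) (z : Fin n → B) :
    polyEval p z = ringEval (gaussScalar B) z p := by
  simp only [polyEval, Algebra.smul_def]; rfl

variable (z : Fin n → B)

theorem polyEval_append (p q : RatStarPoly n) :
    polyEval (p ++ q) z = polyEval p z + polyEval q z := by
  simp only [polyEval_eq_ringEval, ringEval_append]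

theorem polyEval_neg (p : RatStarPoly n) : polyEval (neg p) z = -polyEval p z := by
  simp only [polyEval_eq_ringEval, ringEval_neg]

theorem polyEval_mul (p q : RatStarPoly n) :
    polyEval (mul p q) z = polyEval p z * polyEval q z := by
  simp only [polyEval_eq_ringEval, ringEval_mul _ _ gaussScalar_commute]

theorem polyEval_adj (p : RatStarPoly n) : polyEval (adj p) z = star (polyEval p z) := by
  simp only [polyEval_eq_ringEval, ringEval_adj _ _ gaussScalar_star gaussScalar_commute]

theorem polyEval_scalar (c : GaussRat) : polyEval [(c, [])] z = algebraMap ℂ B c.toComplex := by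
  rw [polyEval_eq_ringEval, ringEval_single]; rfl

theorem polyEval_letter (g : Fin n × Bool) : polyEval (letter g) z = letterEval z g := by
  rw [polyEval_eq_ringEval, ringEval_letter]; rfl

theorem polyEval_subst (q : Fin m → RatStarPoly n) (p : RatStarPoly m) :
    polyEval (subst q p) z = polyEval p (fun k => polyEval (q k) z) := by
  simp only [polyEval_eq_ringEval, ringEval_subst _ _ gaussScalar_star gaussScalar_commute]

theorem polyEval_eq_of_isZero {p q : RatStarPoly n} (h : IsZero (p ++ neg q)) :
    polyEval p z = polyEval q z := by
  simp only [polyEval_eq_ringEval, ringEval_eq_of_isZero _ _ h]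

theorem map_polyEval {C : Type*} [CStarAlgebra C] (φ : B →⋆ₐ[ℂ] C) (p : RatStarPoly n) :
    φ (polyEval p z) = polyEval p (fun k => φ (z k)) := by
  have hw (w : StarWord n) : φ (wordEval z w) = wordEval (fun k => φ (z k)) w := by
    rw [wordEval, map_list_prod, List.map_map, wordEval]
    congr 2
    funext g
    rcases g with ⟨k, _ | _⟩ <;> simp [letterEval, map_star]
  rw [polyEval, map_list_sum, List.map_map, polyEval]
  congr 2
  funext t
  simp [hw, map_smul]

theorem continuous_polyEval (p : RatStarPoly n) :
    Continuous (fun z : Fin n → B => polyEval p z) := by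
  have hl (g : Fin n × Bool) : Continuous (fun z : Fin n → B => letterEval z g) := by
    rcases g with ⟨k, _ | _⟩
    · simpa [letterEval] using continuous_apply k
    · simpa [letterEval] using (continuous_apply k).star
  have hw (w : StarWord n) : Continuous (fun z : Fin n → B => wordEval z w) :=
    continuous_list_prod w fun g _ => hl g
  exact continuous_list_sum p fun t _ => (hw t.2).const_smul _

theorem norm_one_le_one (B : Type v) [CStarAlgebra B] : ‖(1 : B)‖ ≤ 1 := by
  rcases subsingleton_or_nontrivial B with h | h
  · rw [Subsingleton.elim (1 : B) 0, norm_zero]; exact zero_le_one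
  · exact CStarRing.norm_one.le

theorem norm_algebraMap_le (c : ℂ) : ‖algebraMap ℂ B c‖ ≤ ‖c‖ := by
  rw [Algebra.algebraMap_eq_smul_one, norm_smul]
  exact mul_le_of_le_one_right (norm_nonneg c) (norm_one_le_one B)

theorem norm_letterEval (g : Fin n × Bool) : ‖letterEval z g‖ = ‖z g.1‖ := by
  rcases g with ⟨k, _ | _⟩ <;> simp [letterEval]

end PolyEval

end RatStarPoly
end FinCStar

namespace FinCStar

/-! ### Enumerating the closure of a point under binary rules. -/

section Enumeration

variable {α τ : Type} [Primcodable τ]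

/-- Enumeration of the closure of `{d}` under a family of binary rules. -/
def enumRules (d : α) (rule : τ → α → α → α) : ℕ → α
  | 0 => d
  | k + 1 => ((Encodable.decode k.unpair.1 : Option τ).map fun t =>
      rule t (enumRules d rule k.unpair.2.unpair.1) (enumRules d rule k.unpair.2.unpair.2)).getD d
  decreasing_by
  · exact Nat.lt_succ_of_le ((Nat.unpair_left_le _).trans (Nat.unpair_right_le _))
  · exact Nat.lt_succ_of_le ((Nat.unpair_right_le _).trans (Nat.unpair_right_le _))

theorem enumRules_zero (d : α) (rule : τ → α → α → α) : enumRules d rule 0 = d := by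
  rw [enumRules]

theorem enumRules_pair (d : α) (rule : τ → α → α → α) (t : τ) (i j : ℕ) :
    enumRules d rule (Nat.pair (Encodable.encode t) (Nat.pair i j) + 1) =
      rule t (enumRules d rule i) (enumRules d rule j) := by
  rw [enumRules]; simp

theorem enumRules_induction (d : α) (rule : τ → α → α → α) {P : α → Prop} (hd : P d)
    (h : ∀ t a b, P a → P b → P (rule t a b)) (k : ℕ) : P (enumRules d rule k) := by
  induction k using Nat.strong_induction_on with
  | _ k ih =>
    rcases k with _ | k
    · rwa [enumRules_zero]
    · rw [enumRules]
      rcases (Encodable.decode k.unpair.1 : Option τ) with _ | t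
      · exact hd
      · exact h t _ _
          (ih _ (Nat.lt_succ_of_le ((Nat.unpair_left_le _).trans (Nat.unpair_right_le _))))
          (ih _ (Nat.lt_succ_of_le ((Nat.unpair_right_le _).trans (Nat.unpair_right_le _))))

/-- Stage `k + 1` refers only to stages up to `k`, because unpairing does not increase numbers.
Hence the enumeration is a course-of-values recursion on the list of earlier values. -/
theorem primrec_enumRules [Primcodable α] (d : α) (rule : τ → α → α → α)
    (h : Primrec fun x : τ × α × α => rule x.1 x.2.1 x.2.2) : Primrec (enumRules d rule) := by
  let g : Unit → List α → Option α := fun _ l =>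
    Nat.casesOn (motive := fun _ => Option α) l.length (some d) fun k =>
      some (((Encodable.decode k.unpair.1 : Option τ).map fun t =>
        rule t (l.getD k.unpair.2.unpair.1 d) (l.getD k.unpair.2.unpair.2 d)).getD d)
  have hg : Primrec₂ g := by
    refine Primrec.nat_casesOn (α := Unit × List α)
      (h := fun x k => some (((Encodable.decode k.unpair.1 : Option τ).map fun t =>
        rule t (x.2.getD k.unpair.2.unpair.1 d) (x.2.getD k.unpair.2.unpair.2 d)).getD d))
      (Primrec.list_length.comp Primrec.snd) (Primrec.const _) ?_
    refine Primrec.option_some.comp (Primrec.option_getD.comp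
      (Primrec.option_map (Primrec.decode.comp (Primrec.fst.comp (Primrec.unpair.comp Primrec.snd)))
        ?_) (Primrec.const d))
    have hl : Primrec (fun x : ((Unit × List α) × ℕ) × τ => x.1.1.2) :=
      Primrec.snd.comp (Primrec.fst.comp Primrec.fst)
    have hk : Primrec (fun x : ((Unit × List α) × ℕ) × τ => x.1.2.unpair.2.unpair) :=
      Primrec.unpair.comp (Primrec.snd.comp (Primrec.unpair.comp (Primrec.snd.comp Primrec.fst)))
    exact h.comp (Primrec.snd.pair
      (((Primrec.list_getD d).comp hl (Primrec.fst.comp hk)).pair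
        ((Primrec.list_getD d).comp hl (Primrec.snd.comp hk))))
  have H := Primrec.nat_strong_rec (fun _ : Unit => enumRules d rule) hg fun _ n => by
    rcases n with _ | k
    · simp [g, enumRules_zero]
    · have h1 : k.unpair.2.unpair.1 < k + 1 :=
        Nat.lt_succ_of_le ((Nat.unpair_left_le _).trans (Nat.unpair_right_le _))
      have h2 : k.unpair.2.unpair.2 < k + 1 :=
        Nat.lt_succ_of_le ((Nat.unpair_right_le _).trans (Nat.unpair_right_le _))
      simp only [g, List.length_map, List.length_range]
      rw [enumRules]
      simp [List.getD, h1, h2]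
  exact H.comp (Primrec.const ()) Primrec.id

end Enumeration

/-! ### The calculus of norm estimates and its soundness. -/

/-- A code for a norm estimate: `(p, r, d)` states that `‖p(z)‖ ≤ r` for every tuple `z` that
satisfies given relations up to `2⁻ᵈ`. -/
abbrev NormBound (n : ℕ) : Type := RatStarPoly n × BoundCode × ℕ

namespace NormBound

open RatStarPoly

variable {n : ℕ}

/-- the trivial norm estimate `‖0‖ ≤ 0` -/
def trivialBound : NormBound n := ([], (0, 0), 0)

/-- The inference rules for norm estimates. The list `ax` consists of polynomials and bounds for
their norms at exact representations. -/
def infer (ax : List (RatStarPoly n × BoundCode)) (t : ℕ × NormBound n) (a b : NormBound n) :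
    NormBound n :=
  if t.1 = 0 then (a.1 ++ b.1, a.2.1.add b.2.1, max a.2.2 b.2.2)
  else if t.1 = 1 then (mul a.1 b.1, a.2.1.mul b.2.1, max a.2.2 b.2.2)
  -- Tags 2 to 4 take the polynomial of the conclusion from `t` and check a decidable side
  -- condition. If the check fails, no later tag matches and the harmless `trivialBound` results.
  else if t.1 = 2 ∧ IsZero (a.1 ++ neg t.2.1) then (t.2.1, a.2.1, a.2.2)
  else if t.1 = 3 ∧ IsZero (a.1 ++ neg (mul (adj t.2.1) t.2.1)) ∧
    a.2.1.Le (t.2.2.1.mul t.2.2.1) then (t.2.1, t.2.2.1, a.2.2)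
  else if t.1 = 4 ∧ (t.2.1, t.2.2.1) ∈ ax then
    (t.2.1, t.2.2.1.add (BoundCode.twoPow t.2.2.2), t.2.2.2)
  else if t.1 = 5 then ([(t.2.1.headI.1, [])], BoundCode.abs t.2.1.headI.1, 0)
  else trivialBound

theorem primrec_infer (ax : List (RatStarPoly n × BoundCode)) :
    Primrec fun x : (ℕ × NormBound n) × NormBound n × NormBound n => infer ax x.1 x.2.1 x.2.2 := by
  let X := (ℕ × NormBound n) × NormBound n × NormBound n
  have tag : Primrec (fun x : X => x.1.1) := Primrec.fst.comp Primrec.fst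
  have t : Primrec (fun x : X => x.1.2) := Primrec.snd.comp Primrec.fst
  have tp : Primrec (fun x : X => x.1.2.1) := Primrec.fst.comp t
  have tr : Primrec (fun x : X => x.1.2.2.1) := Primrec.fst.comp (Primrec.snd.comp t)
  have td : Primrec (fun x : X => x.1.2.2.2) := Primrec.snd.comp (Primrec.snd.comp t)
  have a : Primrec (fun x : X => x.2.1) := Primrec.fst.comp Primrec.snd
  have ap : Primrec (fun x : X => x.2.1.1) := Primrec.fst.comp a
  have ar : Primrec (fun x : X => x.2.1.2.1) := Primrec.fst.comp (Primrec.snd.comp a)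
  have ad : Primrec (fun x : X => x.2.1.2.2) := Primrec.snd.comp (Primrec.snd.comp a)
  have b : Primrec (fun x : X => x.2.2) := Primrec.snd.comp Primrec.snd
  have bp : Primrec (fun x : X => x.2.2.1) := Primrec.fst.comp b
  have br : Primrec (fun x : X => x.2.2.2.1) := Primrec.fst.comp (Primrec.snd.comp b)
  have bd : Primrec (fun x : X => x.2.2.2.2) := Primrec.snd.comp (Primrec.snd.comp b)
  have htag (i : ℕ) : PrimrecPred (fun x : X => x.1.1 = i) := Primrec.eq.comp tag (Primrec.const i)
  have hmem : PrimrecPred (fun x : X => (x.1.2.1, x.1.2.2.1) ∈ ax) := by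
    refine PrimrecPred.of_eq (PrimrecRel.comp
      (PrimrecRel.exists_mem_list (R := fun y y' : RatStarPoly n × BoundCode => y = y') Primrec.eq)
      (Primrec.const ax) (tp.pair tr)) fun x => ?_
    simp
  have hc : Primrec (fun x : X => x.1.2.1.headI.1) :=
    Primrec.fst.comp (Primrec.list_headI.comp tp)
  refine Primrec.ite (htag 0) ((Primrec.list_append.comp ap bp).pair
    ((BoundCode.primrec_add.comp ar br).pair (Primrec.nat_max.comp ad bd))) ?_
  refine Primrec.ite (htag 1) ((primrec_mul.comp ap bp).pair
    ((BoundCode.primrec_mul.comp ar br).pair (Primrec.nat_max.comp ad bd))) ?_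
  refine Primrec.ite ((htag 2).and (primrec_isZero.comp
    (Primrec.list_append.comp ap (primrec_neg.comp tp)))) (tp.pair (ar.pair ad)) ?_
  refine Primrec.ite ((htag 3).and ((primrec_isZero.comp (Primrec.list_append.comp ap
    (primrec_neg.comp (primrec_mul.comp (primrec_adj.comp tp) tp)))).and
      (BoundCode.primrec_le.comp ar (BoundCode.primrec_mul.comp tr tr)))) (tp.pair (tr.pair ad)) ?_
  refine Primrec.ite ((htag 4).and hmem) (tp.pair ((BoundCode.primrec_add.comp tr
    (BoundCode.primrec_twoPow.comp td)).pair td)) ?_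
  exact Primrec.ite (htag 5) ((Primrec.list_cons.comp (hc.pair (Primrec.const []))
    (Primrec.const [])).pair ((BoundCode.primrec_abs.comp hc).pair (Primrec.const 0)))
    (Primrec.const _)

/-- Closure of a set of norm estimates under the inference rules. -/
structure Closed (ax : List (RatStarPoly n × BoundCode)) (S : NormBound n → Prop) : Prop where
  triv : S trivialBound
  add : ∀ {p q r s d e}, S (p, r, d) → S (q, s, e) → S (p ++ q, r.add s, max d e)
  mul : ∀ {p q r s d e}, S (p, r, d) → S (q, s, e) → S (p.mul q, r.mul s, max d e)
  congr : ∀ {p q r d}, S (p, r, d) → IsZero (p ++ neg q) → S (q, r, d)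
  cstar : ∀ {p q r s d}, S (p, r, d) → IsZero (p ++ neg (RatStarPoly.mul (adj q) q)) →
    r.Le (s.mul s) → S (q, s, d)
  ax : ∀ {p r} d, (p, r) ∈ ax → S (p, r.add (BoundCode.twoPow d), d)
  scalar : ∀ c, S ([(c, [])], BoundCode.abs c, 0)

theorem closed_range_enumRules (ax : List (RatStarPoly n × BoundCode)) :
    Closed ax fun a => ∃ k, enumRules trivialBound (infer ax) k = a where
  triv := ⟨0, enumRules_zero _ _⟩
  add := by
    rintro p q r s d e ⟨i, hi⟩ ⟨j, hj⟩
    exact ⟨_, (enumRules_pair _ _ (0, trivialBound) i j).trans (by simp [hi, hj, infer])⟩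
  mul := by
    rintro p q r s d e ⟨i, hi⟩ ⟨j, hj⟩
    exact ⟨_, (enumRules_pair _ _ (1, trivialBound) i j).trans (by simp [hi, hj, infer])⟩
  congr := by
    rintro p q r d ⟨i, hi⟩ h
    refine ⟨_, (enumRules_pair _ _ (2, (q, r, d)) i 0).trans ?_⟩
    rw [hi, infer, if_neg (by simp), if_neg (by simp), if_pos ⟨rfl, h⟩]
  cstar := by
    rintro p q r s d ⟨i, hi⟩ h hr
    refine ⟨_, (enumRules_pair _ _ (3, (q, s, d)) i 0).trans ?_⟩
    rw [hi, infer, if_neg (by simp), if_neg (by simp), if_neg (by simp), if_pos ⟨rfl, h, hr⟩]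
  ax := by
    rintro p r d h
    refine ⟨_, (enumRules_pair _ _ (4, (p, r, d)) 0 0).trans ?_⟩
    rw [infer, if_neg (by simp), if_neg (by simp), if_neg (by simp), if_neg (by simp),
      if_pos ⟨rfl, h⟩]
  scalar c := ⟨_, (enumRules_pair _ _ (5, ([(c, [])], (0, 0), 0)) 0 0).trans (by simp [infer])⟩

/-- The norm estimate holds at all approximate representations in the C*-algebra `B`. -/
def Valid (R : FinRelations n) (B : Type v) [CStarAlgebra B] (a : NormBound n) : Prop :=
  ∀ z : Fin n → B, R.IsApproxRep ((1 / 2 : ℝ) ^ a.2.2) z → ‖polyEval a.1 z‖ ≤ a.2.1.val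

end NormBound

theorem FinRelations.IsApproxRep.mono {n : ℕ} {R : FinRelations n} {B : Type v} [CStarAlgebra B]
    {δ ε : ℝ} (h : δ ≤ ε) {z : Fin n → B} (hz : R.IsApproxRep δ z) : R.IsApproxRep ε z :=
  ⟨fun p hp => (hz.1 p hp).trans h, fun k => (hz.2 k).trans (by gcongr)⟩

theorem half_pow_anti {d e : ℕ} (h : d ≤ e) : (1 / 2 : ℝ) ^ e ≤ (1 / 2 : ℝ) ^ d :=
  pow_le_pow_of_le_one (by norm_num) (by norm_num) h

namespace NormBound

open RatStarPoly

variable {n : ℕ}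

/-- A larger exponent is a smaller tolerance, so two premises hold together at the maximum of their
exponents. Rule 3 is sound by the C*-identity: `‖q(z)‖² = ‖(q*q)(z)‖ ≤ s²`. -/
theorem Valid.infer {R : FinRelations n} {B : Type v} [CStarAlgebra B]
    {ax : List (RatStarPoly n × BoundCode)}
    (hax : ∀ a ∈ ax, ∀ δ, ∀ z : Fin n → B, R.IsApproxRep δ z → ‖polyEval a.1 z‖ ≤ a.2.val + δ)
    (t : ℕ × NormBound n) (a b : NormBound n) (ha : Valid R B a) (hb : Valid R B b) :
    Valid R B (infer ax t a b) := by
  intro z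
  rw [NormBound.infer]
  split_ifs with h0 h1 h2 h3 h4 h5
  · intro hz
    have h1 := ha z (hz.mono (half_pow_anti (le_max_left _ _)))
    have h2 := hb z (hz.mono (half_pow_anti (le_max_right _ _)))
    rw [polyEval_append, BoundCode.val_add]
    exact (norm_add_le _ _).trans (add_le_add h1 h2)
  · intro hz
    have h1 := ha z (hz.mono (half_pow_anti (le_max_left _ _)))
    have h2 := hb z (hz.mono (half_pow_anti (le_max_right _ _)))
    rw [polyEval_mul, BoundCode.val_mul]
    exact (norm_mul_le _ _).trans (mul_le_mul h1 h2 (norm_nonneg _) (BoundCode.val_nonneg _))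
  · intro hz
    have h := ha z hz
    rwa [polyEval_eq_of_isZero z h2.2] at h
  · intro hz
    have h := (ha z hz).trans ((BoundCode.le_iff _ _).1 h3.2.2)
    rw [polyEval_eq_of_isZero z h3.2.1, polyEval_mul, polyEval_adj, CStarRing.norm_star_mul_self,
      BoundCode.val_mul] at h
    exact abs_le_of_sq_le_sq' (by nlinarith) (BoundCode.val_nonneg _) |>.2
  · intro hz
    rw [BoundCode.val_add, BoundCode.val_twoPow]
    exact hax _ h4.2 _ z hz
  · intro _
    rw [polyEval_scalar]
    exact (norm_algebraMap_le _).trans (BoundCode.norm_toComplex_le _)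
  · intro _
    simp [trivialBound, polyEval, BoundCode.val_zero]

end NormBound
end FinCStar

/-! ### Completeness of the calculus, through the seminorm of derivable bounds. -/

namespace FinCStar

namespace RatStarPoly

theorem map_ringEval {n : ℕ} {S T : Type*} [Ring S] [StarRing S] [Ring T] [StarRing T] (ι : S →+* T)
    (hι : ∀ a, ι (star a) = star (ι a)) (κ : gaussRing →+* S) (v : Fin n → S) (p : RatStarPoly n) :
    ι (ringEval κ v p) = ringEval (ι.comp κ) (fun k => ι (v k)) p := by
  have hw (w : StarWord n) : ι (ringWord v w) = ringWord (fun k => ι (v k)) w := by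
    rw [ringWord, map_list_prod, List.map_map, ringWord]
    congr 2
    funext g
    rcases g with ⟨k, _ | _⟩ <;> simp [ringLetter, hι]
  rw [ringEval, map_list_sum, List.map_map, ringEval]
  congr 2
  funext t
  simp [hw]

end RatStarPoly

/-- The code `abs c` only gives the sum of the moduli of the real and imaginary parts. For the
nonnegative real number `c̄c` it is exact, and so the C*-rule recovers the true modulus of a scalar.
-/
theorem BoundCode.val_abs_conj_mul (c : GaussRat) :
    (BoundCode.abs (c.conj.mul c)).val = ‖c.toComplex‖ * ‖c.toComplex‖ := by
  have h : ‖(c.2 : ℂ) + 1‖ = c.2 + 1 := by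
    rw [show (c.2 : ℂ) + 1 = ((c.2 + 1 : ℕ) : ℂ) by push_cast; rfl, Complex.norm_natCast]
    push_cast; rfl
  have e1 : (c.conj.mul c).1.1 = c.1.1 * c.1.1 + c.1.2 * c.1.2 := by
    simp only [GaussRat.mul, GaussRat.conj]; ring
  have e2 : (c.conj.mul c).1.2 = 0 := by simp only [GaussRat.mul, GaussRat.conj]; ring
  have e3 : (c.conj.mul c).2 = c.2 * c.2 + c.2 + c.2 := rfl
  have e4 : ((c.1.1 * c.1.1 + c.1.2 * c.1.2).natAbs : ℝ) = c.1.1 * c.1.1 + c.1.2 * c.1.2 := by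
    rw [Nat.cast_natAbs, abs_of_nonneg (add_nonneg (mul_self_nonneg _) (mul_self_nonneg _))]
    push_cast; rfl
  have e5 : ‖(c.1.1 : ℂ) + (c.1.2 : ℂ) * Complex.I‖ * ‖(c.1.1 : ℂ) + (c.1.2 : ℂ) * Complex.I‖ =
      (c.1.1 : ℝ) * c.1.1 + c.1.2 * c.1.2 := by
    rw [Complex.norm_mul_self_eq_normSq, Complex.normSq_apply]
    simp
  rw [GaussRat.toComplex, norm_div, h, div_mul_div_comm, e5, val, abs, e1, e2, e3]
  push_cast
  rw [e4]
  congr 1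
  · simp
  · ring

namespace NormBound

open RatStarPoly

variable {n : ℕ} {ax : List (RatStarPoly n × BoundCode)} {S : NormBound n → Prop}

/-- the values of the derivable bounds for the norm of an element of the free `*`-algebra -/
def boundSet (S : NormBound n → Prop) (a : FreeStar.{u} n) : Set ℝ :=
  {r | ∃ p b d, S (p, b, d) ∧ toFree p = a ∧ b.val = r}

/-- the seminorm on the free `*`-algebra that is given by the derivable norm estimates -/
noncomputable def freeNorm (S : NormBound n → Prop) (a : FreeStar.{u} n) : ℝ := sInf (boundSet S a)

theorem freeNorm_nonneg (a : FreeStar.{u} n) : 0 ≤ freeNorm S a :=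
  Real.sInf_nonneg fun _ ⟨_, b, _, _, _, h⟩ => h ▸ b.val_nonneg

theorem freeNorm_le {p : RatStarPoly n} {b : BoundCode} {d : ℕ} (h : S (p, b, d))
    {a : FreeStar.{u} n} (ha : toFree p = a) : freeNorm S a ≤ b.val :=
  csInf_le ⟨0, fun _ ⟨_, b, _, _, _, h⟩ => h ▸ b.val_nonneg⟩ ⟨p, b, d, h, ha, rfl⟩

theorem toFree_append (p q : RatStarPoly n) :
    (toFree (p ++ q) : FreeStar.{u} n) = toFree p + toFree q := ringEval_append _ _ p q

theorem toFree_mul (p q : RatStarPoly n) :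
    (toFree (p.mul q) : FreeStar.{u} n) = toFree p * toFree q :=
  ringEval_mul _ _ FreeStar.commute_scalar p q

theorem toFree_adj (p : RatStarPoly n) : (toFree p.adj : FreeStar.{u} n) = star (toFree p) :=
  ringEval_adj _ _ FreeStar.scalar_star FreeStar.commute_scalar p

theorem toFree_scalar (c : GaussRat) :
    (toFree [(c, [])] : FreeStar.{u} n) = FreeStar.scalar c.toRing := ringEval_single _ _ c

theorem toFree_letter (g : Fin n × Bool) :
    (toFree (letter g) : FreeStar.{u} n) = FreeStar.monomial [g] 1 := by
  rw [letter, toFree_cons, toFree_nil, add_zero, GaussRat.toRing_one]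

section Closed

variable (hS : Closed ax S)
include hS

/-- Without this, `sInf` could take its default value `0` on an empty set. Bounds on letters and
scalars propagate to all polynomials. -/
theorem Closed.boundSet_nonempty (hl : ∀ g, ∃ b, (letter g, b) ∈ ax) (a : FreeStar.{u} n) :
    (boundSet S a).Nonempty := by
  induction a using FreeStar.induction with
  | h0 => exact ⟨_, [], _, _, hS.triv, rfl, rfl⟩
  | hadd a b ha hb =>
    obtain ⟨_, p, r, d, hp, rfl, -⟩ := ha
    obtain ⟨_, q, s, e, hq, rfl, -⟩ := hb
    exact ⟨_, _, _, _, hS.add hp hq, toFree_append p q, rfl⟩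
  | hm w c =>
    induction w with
    | nil =>
      obtain ⟨c, rfl⟩ := GaussRat.toRing_surjective c
      exact ⟨_, _, _, _, hS.scalar c, toFree_scalar c, rfl⟩
    | cons g w ih =>
      obtain ⟨b, hb⟩ := hl g
      obtain ⟨_, p, r, d, hp, hpw, -⟩ := ih
      refine ⟨_, _, _, _, hS.mul (hS.ax 0 hb) hp, ?_, rfl⟩
      rw [toFree_mul, hpw, toFree_letter, FreeStar.monomial_mul, one_mul]
      rfl

theorem Closed.exists_lt (hl : ∀ g, ∃ b, (letter g, b) ∈ ax) {a : FreeStar.{u} n} {r : ℝ}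
    (h : freeNorm S a < r) : ∃ p b d, S (p, b, d) ∧ toFree p = a ∧ b.val < r := by
  obtain ⟨_, ⟨p, b, d, hp, ha, rfl⟩, hr⟩ := exists_lt_of_csInf_lt (hS.boundSet_nonempty hl a) h
  exact ⟨p, b, d, hp, ha, hr⟩

theorem Closed.freeNorm_zero : freeNorm S (0 : FreeStar.{u} n) = 0 :=
  le_antisymm ((freeNorm_le hS.triv rfl).trans BoundCode.val_zero.le) (freeNorm_nonneg _)

theorem Closed.freeNorm_add_le (hl : ∀ g, ∃ b, (letter g, b) ∈ ax) (a b : FreeStar.{u} n) :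
    freeNorm S (a + b) ≤ freeNorm S a + freeNorm S b := by
  refine le_of_forall_pos_le_add fun ε hε => ?_
  obtain ⟨p, r, d, hp, rfl, hr⟩ := hS.exists_lt hl (lt_add_of_pos_right (freeNorm S a) (half_pos hε))
  obtain ⟨q, s, e, hq, rfl, hs⟩ := hS.exists_lt hl (lt_add_of_pos_right (freeNorm S b) (half_pos hε))
  have h := freeNorm_le (hS.add hp hq) (toFree_append.{u} p q)
  rw [BoundCode.val_add] at h
  linarith

theorem Closed.freeNorm_mul_le (hl : ∀ g, ∃ b, (letter g, b) ∈ ax) (a b : FreeStar.{u} n) :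
    freeNorm S (a * b) ≤ freeNorm S a * freeNorm S b := by
  have key (ε : ℝ) (hε : 0 < ε) : freeNorm S (a * b) ≤ (freeNorm S a + ε) * (freeNorm S b + ε) := by
    obtain ⟨p, r, d, hp, ha, hr⟩ := hS.exists_lt hl (lt_add_of_pos_right (freeNorm S a) hε)
    obtain ⟨q, s, e, hq, hb, hs⟩ := hS.exists_lt hl (lt_add_of_pos_right (freeNorm S b) hε)
    have h := freeNorm_le (hS.mul hp hq) (toFree_mul.{u} p q)
    rw [BoundCode.val_mul, ha, hb] at h
    exact h.trans (mul_le_mul hr.le hs.le s.val_nonneg (add_nonneg (freeNorm_nonneg a) hε.le))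
  -- The infima need not be attained, so the estimate is proved with slack `ε` and `ε` tends to `0`.
  have hc : Filter.Tendsto (fun ε : ℝ => (freeNorm S a + ε) * (freeNorm S b + ε))
      (nhdsWithin 0 (Set.Ioi 0)) (nhds (freeNorm S a * freeNorm S b)) := by
    have : Continuous (fun ε : ℝ => (freeNorm S a + ε) * (freeNorm S b + ε)) := by fun_prop
    simpa using (this.tendsto 0).mono_left nhdsWithin_le_nhds
  exact ge_of_tendsto hc (eventually_mem_nhdsWithin.mono key)

theorem Closed.freeNorm_mul_self_le (hl : ∀ g, ∃ b, (letter g, b) ∈ ax) (a : FreeStar.{u} n) :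
    freeNorm S a * freeNorm S a ≤ freeNorm S (star a * a) := by
  refine le_of_forall_gt_imp_ge_of_dense fun t ht => ?_
  obtain ⟨p, r, d, hp, hpa, hr⟩ := hS.exists_lt hl ht
  obtain ⟨q, rfl⟩ := toFree_surjective a
  -- The C*-rule needs a rational bound `s` with `r ≤ s²`; the square root of `r` may be irrational,
  -- so `s` is taken between `√r` and `√t`.
  obtain ⟨s, hs1, hs2⟩ := BoundCode.exists_val_between (Real.sqrt_nonneg _)
    (Real.sqrt_lt_sqrt r.val_nonneg hr)
  have hrs : r.Le (s.mul s) := by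
    rw [BoundCode.le_iff, BoundCode.val_mul]
    exact (Real.sqrt_le_left s.val_nonneg).1 hs1.le |>.trans_eq (sq _)
  have hz : IsZero (p ++ neg (RatStarPoly.mul (adj q) q)) := by
    rw [isZero_append_neg_iff.{u}, toFree_mul, toFree_adj, hpa]
  have h := freeNorm_le (hS.cstar hp hz hrs) (rfl : toFree.{u} q = _)
  have ht0 : 0 ≤ t := r.val_nonneg.trans hr.le
  calc _ ≤ √t * √t := mul_self_le_mul_self (freeNorm_nonneg _) (h.trans hs2.le)
    _ = t := Real.mul_self_sqrt ht0

/-- The crude scalar rule applied to `c̄c` is exact, and the C*-inequality takes the square root. -/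
theorem Closed.freeNorm_scalar_le (hl : ∀ g, ∃ b, (letter g, b) ∈ ax) (c : gaussRing) :
    freeNorm S (FreeStar.scalar c : FreeStar.{u} n) ≤ ‖(c : ℂ)‖ := by
  obtain ⟨c, rfl⟩ := GaussRat.toRing_surjective c
  refine abs_le_of_sq_le_sq' ?_ (norm_nonneg _) |>.2
  rw [sq, sq]
  refine (hS.freeNorm_mul_self_le hl _).trans ?_
  refine (freeNorm_le (hS.scalar (c.conj.mul c)) ?_).trans_eq (BoundCode.val_abs_conj_mul c)
  rw [toFree_scalar, GaussRat.toRing_mul, GaussRat.toRing_conj, map_mul, FreeStar.scalar_star]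

theorem Closed.freeNorm_neg_le (hl : ∀ g, ∃ b, (letter g, b) ∈ ax) (a : FreeStar.{u} n) :
    freeNorm S (-a) ≤ freeNorm S a := by
  have h1 := hS.freeNorm_scalar_le.{u} hl (-1)
  have h2 := hS.freeNorm_mul_le hl (FreeStar.scalar (-1)) a
  rw [map_neg, map_one] at h1 h2
  rw [neg_one_mul] at h2
  refine h2.trans (mul_le_of_le_one_left (freeNorm_nonneg a) (h1.trans ?_))
  simp

/-- Completeness of the inference rules: every strict upper bound of the norm of a rational point
in the universal C*-algebra can be derived. -/
theorem Closed.exists_of_norm_lt {R : FinRelations n}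
    (hrel : ∀ p ∈ R.rels, (p, ((0, 0) : BoundCode)) ∈ ax)
    (hlet : ∀ g, ∃ b : BoundCode, b.val = R.bound g.1 ∧ (letter g, b) ∈ ax)
    {A : Type u} [CStarAlgebra A] {x : Fin n → A} (hx : R.IsUniversal x) {p : RatStarPoly n} {r : ℝ}
    (hr : ‖polyEval p x‖ < r) : ∃ b d, S (p, b, d) ∧ b.val < r := by
  have hl (g) : ∃ b, (letter g, b) ∈ ax := (hlet g).imp fun _ h => h.2
  let _ : SeminormedRing (FreeStar.{u} n) := RingSeminorm.toSeminormedRing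
    { toFun := freeNorm S
      map_zero' := hS.freeNorm_zero
      add_le' := hS.freeNorm_add_le hl
      neg' := fun a => le_antisymm (hS.freeNorm_neg_le hl a)
        (by simpa using hS.freeNorm_neg_le hl (-a))
      mul_le' := hS.freeNorm_mul_le hl }
  obtain ⟨C, _, ι, hn, hs, hκ⟩ := exists_cstarAlgebra_completion (R := FreeStar.{u} n)
    FreeStar.scalar (hS.freeNorm_scalar_le hl) FreeStar.scalar_star FreeStar.commute_scalar
    (hS.freeNorm_mul_self_le hl)
  have hn' (a : FreeStar.{u} n) : ‖ι a‖ = freeNorm S a := hn a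
  have hev (q : RatStarPoly n) : polyEval q (fun k => ι (FreeStar.gen k)) = ι (toFree q) := by
    rw [polyEval_eq_ringEval, toFree, map_ringEval ι hs]
    congr 1
    exact RingHom.ext fun c => (hκ c).symm
  -- An axiom is derivable with error `2⁻ᵈ` for every `d`, and `freeNorm` forgets the tolerance. So
  -- the error disappears and the generators satisfy the relations exactly in the completion.
  have hax {q : RatStarPoly n} {b : BoundCode} (h : (q, b) ∈ ax) :
      freeNorm S (toFree q : FreeStar.{u} n) ≤ b.val := by
    have hd (d : ℕ) : freeNorm S (toFree q : FreeStar.{u} n) ≤ b.val + (1 / 2 : ℝ) ^ d := by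
      have := freeNorm_le (hS.ax d h) (rfl : toFree.{u} q = _)
      rwa [BoundCode.val_add, BoundCode.val_twoPow] at this
    have ht : Filter.Tendsto (fun d : ℕ => b.val + (1 / 2 : ℝ) ^ d) Filter.atTop (nhds b.val) := by
      simpa using (tendsto_pow_atTop_nhds_zero_of_lt_one (r := (1 / 2 : ℝ)) (by norm_num)
        (by norm_num)).const_add b.val
    exact ge_of_tendsto' ht hd
  have hrep : R.IsRep fun k => ι (FreeStar.gen k) := by
    refine ⟨fun q hq => ?_, fun k => ?_⟩
    · rw [hev, ← norm_le_zero_iff, hn']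
      exact (hax (hrel q hq)).trans_eq BoundCode.val_zero
    · obtain ⟨b, hb, hm⟩ := hlet (k, false)
      rw [hn', ← hb]
      have := hax hm
      rwa [toFree_letter] at this
  -- Universality enters here: `φ` is contractive and sends `p(x)` to the class of `p`, so the
  -- seminorm of `p` is at most `‖p(x)‖`.
  obtain ⟨φ, hφ, -⟩ := hx.2 C _ hrep
  have hle : freeNorm S (toFree p : FreeStar.{u} n) < r := by
    rw [← hn', ← hev, ← funext hφ, ← map_polyEval]
    exact (NonUnitalStarAlgHom.norm_apply_le φ _).trans_lt hr
  obtain ⟨q, b, d, hq, hqp, hb⟩ := hS.exists_lt hl hle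
  -- The derived estimate concerns a polynomial that equals `p` only in the free `*`-algebra; the
  -- congruence rule moves it to `p` itself.
  exact ⟨b, d, hS.congr hq (isZero_append_neg_iff.2 hqp), hb⟩

end Closed

end NormBound

theorem FinRelations.exists_bound_codes {n : ℕ} (R : FinRelations n) :
    ∃ γ : Fin n → BoundCode, ∀ k, (γ k).val = R.bound k := by
  have h (k : Fin n) : ∃ b : BoundCode, b.val = R.bound k := by
    obtain ⟨a, b, h⟩ := R.bound_dyadic k
    exact h ▸ BoundCode.exists_val_eq_dyadic a b
  choose γ hγ using h
  exact ⟨γ, hγ⟩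

open RatStarPoly in
/-- The valid norm estimates for rational points of a universal C*-algebra on finitely many rational
relations can be enumerated by an algorithm. -/
theorem FinRelations.exists_enumeration {n : ℕ} (R : FinRelations n) :
    ∃ e : ℕ → NormBound n, Primrec e ∧
      (∀ k (B : Type u) [CStarAlgebra B], (e k).Valid R B) ∧
      ∀ (A : Type u) [CStarAlgebra A] (x : Fin n → A), R.IsUniversal x →
        ∀ p r, ‖polyEval p x‖ < r → ∃ k b d, e k = (p, b, d) ∧ b.val < r := by
  obtain ⟨β, hβ⟩ := R.exists_bound_codes
  -- The relations have bound `0`. Adjoint letters are included with the bounds of the generators,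
  -- so that every word receives a bound.
  let ax : List (RatStarPoly n × BoundCode) := R.rels.map (fun p => (p, (0, 0))) ++
    (Finset.univ : Finset (Fin n × Bool)).toList.map fun g => (letter g, β g.1)
  refine ⟨enumRules NormBound.trivialBound (NormBound.infer ax),
    primrec_enumRules _ _ (NormBound.primrec_infer ax), fun k B _ => ?_, fun A _ x hx p r hr => ?_⟩
  · refine enumRules_induction _ _ (fun z _ => ?_) (NormBound.Valid.infer ?_) k
    · simp [NormBound.trivialBound, polyEval, BoundCode.val_zero]
    · intro a ha δ z hz
      rcases List.mem_append.1 ha with ha | ha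
      · obtain ⟨p, hp, rfl⟩ := List.mem_map.1 ha
        simpa [BoundCode.val_zero] using hz.1 p hp
      · obtain ⟨g, -, rfl⟩ := List.mem_map.1 ha
        rw [polyEval_letter, norm_letterEval, hβ]
        exact hz.2 g.1
  · obtain ⟨b, d, ⟨k, hk⟩, hbr⟩ := (NormBound.closed_range_enumRules ax).exists_of_norm_lt
      (fun q hq => List.mem_append_left _ (List.mem_map.2 ⟨q, hq, rfl⟩))
      (fun g => ⟨β g.1, hβ g.1, List.mem_append_right _
        (List.mem_map.2 ⟨g, Finset.mem_toList.2 (Finset.mem_univ g), rfl⟩)⟩) hx hr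
    exact ⟨k, b, d, hk, hbr⟩

end FinCStar

namespace FinCStar
open RatStarPoly

/-! ### Searching for certified estimates. -/

section Search

variable {α β : Type} [Primcodable α] [Primcodable β]

/-- Unbounded search for a witness of a primitive recursive relation. -/
theorem exists_computable_of_forall_exists {p : α → β → Prop} (hp : PrimrecRel p) {a : ℕ → α}
    (ha : Computable a) (h : ∀ n, ∃ b, p (a n) b) :
    ∃ f : ℕ → β, Computable f ∧ ∀ n, p (a n) (f n) := by
  classical
  let F : α → ℕ → Option β := fun x k =>
    (Encodable.decode k : Option β).bind fun b => if p x b then some b else none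
  have hF : Primrec₂ F := by
    refine Primrec.option_bind (α := α × ℕ) (Primrec.decode.comp Primrec.snd) ?_
    exact Primrec.ite (hp.comp (Primrec.fst.comp Primrec.fst) Primrec.snd)
      (Primrec.option_some.comp Primrec.snd) (Primrec.const none)
  have hFp {x k b} (hb : b ∈ F x k) : p x b := by
    obtain ⟨c, -, hc⟩ := Option.bind_eq_some_iff.1 hb
    split_ifs at hc with h
    exact Option.some.inj hc ▸ h
  have hs : Partrec fun n => Nat.rfindOpt (F (a n)) :=
    Partrec.rfindOpt (hF.to_comp.comp (ha.comp Computable.fst) Computable.snd)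
  have hd (n : ℕ) : (Nat.rfindOpt (F (a n))).Dom := by
    obtain ⟨b, hb⟩ := h n
    exact Nat.rfindOpt_dom.2 ⟨Encodable.encode b, b, by simp [F, hb]⟩
  refine ⟨fun n => (Nat.rfindOpt (F (a n))).get (hd n), hs.of_eq_tot fun n => Part.get_mem _,
    fun n => ?_⟩
  obtain ⟨k, hk⟩ := Nat.rfindOpt_spec (Part.get_mem (hd n))
  exact hFp hk

/-- Given strict upper bounds for the norms of rational points that hold, for a suitable parameter
`b`, in a universal C*-algebra, an algorithm finds such a `b` together with a precision `d` such that
the bounds hold at all `2⁻ᵈ`-approximate representations. -/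
theorem FinRelations.exists_computable_modulus {n : ℕ} (R : FinRelations n) {A : Type u}
    [CStarAlgebra A] {x : Fin n → A} (hx : R.IsUniversal x)
    {T : α → β → List (RatStarPoly n × BoundCode)} (hT : Primrec₂ T) {a : ℕ → α}
    (ha : Computable a) (h : ∀ i, ∃ b, ∀ t ∈ T (a i) b, ‖polyEval t.1 x‖ < t.2.val) :
    ∃ f : ℕ → β × ℕ, Computable f ∧ ∀ i (B : Type u) [CStarAlgebra B] (z : Fin n → B),
      R.IsApproxRep ((1 / 2 : ℝ) ^ (f i).2) z →
        ∀ t ∈ T (a i) (f i).1, ‖polyEval t.1 z‖ ≤ t.2.val := by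
  obtain ⟨e, he, hsound, hcomplete⟩ := FinRelations.exists_enumeration.{u} R
  let ok : ℕ → (RatStarPoly n × BoundCode) × ℕ → Prop := fun c t =>
    ((e c).1 = t.1.1 ∧ (e c).2.1.Le t.1.2) ∧ (e c).2.2 ≤ t.2
  have hok : PrimrecRel ok := by
    have hc : Primrec (fun y : ℕ × ((RatStarPoly n × BoundCode) × ℕ) => e y.1) :=
      he.comp Primrec.fst
    have ht : Primrec (fun y : ℕ × ((RatStarPoly n × BoundCode) × ℕ) => y.2.1) :=
      Primrec.fst.comp Primrec.snd
    exact ((Primrec.eq.comp (Primrec.fst.comp hc) (Primrec.fst.comp ht)).and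
      (BoundCode.primrec_le.comp (Primrec.fst.comp (Primrec.snd.comp hc))
        (Primrec.snd.comp ht))).and
      (Primrec.nat_le.comp (Primrec.snd.comp (Primrec.snd.comp hc)) (Primrec.snd.comp Primrec.snd))
  let ok' : RatStarPoly n × BoundCode → List ℕ × ℕ → Prop := fun t y => ∃ c ∈ y.1, ok c (t, y.2)
  have hok' : PrimrecRel ok' :=
    hok.exists_mem_list.comp (Primrec.fst.comp Primrec.snd)
      (Primrec.fst.pair (Primrec.snd.comp Primrec.snd))
  -- The witness carries a list of stages of the enumeration, which leaves only quantifiers over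
  -- finite lists and keeps the relation primitive recursive.
  let p : α → (β × ℕ) × List ℕ → Prop := fun x y => ∀ t ∈ T x y.1.1, ok' t (y.2, y.1.2)
  have hp : PrimrecRel p :=
    hok'.forall_mem_list.comp
      (hT.comp Primrec.fst (Primrec.fst.comp (Primrec.fst.comp Primrec.snd)))
      ((Primrec.snd.comp Primrec.snd).pair (Primrec.snd.comp (Primrec.fst.comp Primrec.snd)))
  obtain ⟨f, hf, hfp⟩ := exists_computable_of_forall_exists hp ha fun i => by
    obtain ⟨b, hb⟩ := h i
    have hex (t) (ht : t ∈ T (a i) b) : ∃ c, (e c).1 = t.1 ∧ (e c).2.1.Le t.2 := by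
      obtain ⟨k, r, d, hk, hr⟩ := hcomplete A x hx t.1 t.2.val (hb t ht)
      exact ⟨k, by rw [hk], by rw [hk, BoundCode.le_iff]; exact hr.le⟩
    choose! c hc1 hc2 using hex
    -- The sum of the exponents serves as a common upper bound for them.
    refine ⟨((b, (((T (a i) b).map c).map fun k => (e k).2.2).sum), (T (a i) b).map c),
      fun t ht => ⟨c t, List.mem_map_of_mem ht, ⟨hc1 t ht, hc2 t ht⟩, ?_⟩⟩
    exact List.le_sum_of_mem (List.mem_map_of_mem (List.mem_map_of_mem ht))
  refine ⟨fun i => (f i).1, Computable.fst.comp hf, fun i B _ z hz t ht => ?_⟩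
  obtain ⟨c, -, ⟨h1, h2⟩, h3⟩ := hfp i t ht
  rw [← h1]
  exact (hsound c B z (hz.mono (half_pow_anti h3))).trans ((BoundCode.le_iff _ _).1 h2)

end Search

/-! ### Density of the rational points. -/

section Density

variable {n : ℕ} {A : Type u} [CStarAlgebra A]

/-- The closure of the set of rational points is a C*-subalgebra. -/
def closureRationalPoints (x : Fin n → A) : StarSubalgebra ℂ A where
  carrier := closure (Set.range fun p : RatStarPoly n => polyEval p x)
  mul_mem' ha hb := map_mem_closure₂ continuous_mul ha hb <| by
    rintro _ ⟨p, rfl⟩ _ ⟨q, rfl⟩; exact ⟨p.mul q, polyEval_mul x p q⟩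
  add_mem' ha hb := map_mem_closure₂ continuous_add ha hb <| by
    rintro _ ⟨p, rfl⟩ _ ⟨q, rfl⟩; exact ⟨p ++ q, polyEval_append x p q⟩
  algebraMap_mem' c := map_mem_closure (continuous_algebraMap ℂ A) (denseRange_gaussRing c) <| by
    rintro _ ⟨c, rfl⟩
    obtain ⟨c, rfl⟩ := GaussRat.toRing_surjective c
    exact ⟨[(c, [])], polyEval_scalar x c⟩
  star_mem' ha := map_mem_closure continuous_star ha <| by
    rintro _ ⟨p, rfl⟩; exact ⟨p.adj, polyEval_adj x p⟩

/-- The rational points are dense in a universal C*-algebra. -/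
theorem FinRelations.IsUniversal.denseRange_polyEval {R : FinRelations n} {x : Fin n → A}
    (hx : R.IsUniversal x) : DenseRange fun p : RatStarPoly n => polyEval p x := by
  have hcl : IsClosed (closureRationalPoints x : Set A) := isClosed_closure
  let z : Fin n → closureRationalPoints x := fun k =>
    ⟨x k, subset_closure ⟨letter (k, false), polyEval_letter x (k, false)⟩⟩
  have hz : R.IsRep z := by
    refine ⟨fun p hp => Subtype.ext ?_, hx.1.2⟩
    exact (map_polyEval z (closureRationalPoints x).subtype p).trans (hx.1.1 p hp)
  obtain ⟨φ, hφ, -⟩ := hx.2 _ z hz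
  -- The composite and the identity agree on the generators, so uniqueness makes them equal and
  -- every element of `A` lies in the closure.
  have h : (closureRationalPoints x).subtype.comp φ = StarAlgHom.id ℂ A :=
    (hx.2 A x hx.1).unique (fun k => congrArg Subtype.val (hφ k)) fun k => rfl
  intro a
  have ha := (φ a).2
  rwa [show ((φ a : closureRationalPoints x) : A) = a from DFunLike.congr_fun h a] at ha

end Density

/-! ### Computable Lipschitz constants for polynomials on bounded tuples. -/

section Lipschitz

variable {n : ℕ}

/-- a Lipschitz constant for a rational `*`-polynomial on the tuples of norm at most `M` -/
def lipschitzBound (M : ℕ) (p : RatStarPoly n) : ℕ :=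
  p.foldr (fun t c => (t.1.1.1.natAbs + t.1.1.2.natAbs) * (t.2.length * M ^ t.2.length) + c) 0

theorem primrec_lipschitzBound (M : ℕ) : Primrec (lipschitzBound M : RatStarPoly n → ℕ) := by
  refine Primrec.list_foldr (α := RatStarPoly n)
    (h := fun _ x => (x.1.1.1.1.natAbs + x.1.1.1.2.natAbs) *
      (x.1.2.length * M ^ x.1.2.length) + x.2) Primrec.id (Primrec.const 0) ?_
  have t : Primrec (fun x : RatStarPoly n × ((GaussRat × StarWord n) × ℕ) => x.2.1) :=
    Primrec.fst.comp Primrec.snd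
  have c : Primrec (fun x : RatStarPoly n × ((GaussRat × StarWord n) × ℕ) => x.2.1.1.1) :=
    Primrec.fst.comp (Primrec.fst.comp t)
  have w : Primrec (fun x : RatStarPoly n × ((GaussRat × StarWord n) × ℕ) => x.2.1.2.length) :=
    Primrec.list_length.comp (Primrec.snd.comp t)
  exact Primrec.nat_add.comp (Primrec.nat_mul.comp
    (Primrec.nat_add.comp (primrec_int_natAbs.comp (Primrec.fst.comp c))
      (primrec_int_natAbs.comp (Primrec.snd.comp c)))
    (Primrec.nat_mul.comp w (BoundCode.primrec_nat_pow.comp (Primrec.const M) w)))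
    (Primrec.snd.comp Primrec.snd)

variable {B : Type v} [CStarAlgebra B] {z w : Fin n → B} {M : ℕ} {δ : ℝ}

theorem norm_wordEval_le (hz : ∀ k, ‖z k‖ ≤ M) (s : StarWord n) :
    ‖wordEval z s‖ ≤ (M : ℝ) ^ s.length := by
  induction s with
  | nil => simpa [wordEval] using norm_one_le_one B
  | cons g s ih =>
    rw [wordEval, List.map_cons, List.prod_cons, List.length_cons, pow_succ']
    exact (norm_mul_le _ _).trans
      (mul_le_mul ((norm_letterEval z g).trans_le (hz _)) ih (norm_nonneg _) (Nat.cast_nonneg _))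

/-- Replacing the letters one at a time costs `δ` times a product of the other letters; `1 ≤ M` lets
all these products be bounded by the same power of `M`. -/
theorem norm_wordEval_sub_le (hM : 1 ≤ M) (hz : ∀ k, ‖z k‖ ≤ M) (hw : ∀ k, ‖w k‖ ≤ M)
    (hzw : ∀ k, ‖z k - w k‖ ≤ δ) (s : StarWord n) :
    ‖wordEval z s - wordEval w s‖ ≤ s.length * (M : ℝ) ^ s.length * δ := by
  induction s with
  | nil => simp [wordEval]
  | cons g s ih =>
    have hM' : (1 : ℝ) ≤ M := by exact_mod_cast hM
    have hδ : 0 ≤ δ := (norm_nonneg _).trans (hzw g.1)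
    have hg : ‖letterEval z g - letterEval w g‖ ≤ δ := by
      rcases g with ⟨k, _ | _⟩
      · simpa [letterEval] using hzw k
      · simpa [letterEval, ← star_sub] using hzw k
    have e : wordEval z (g :: s) - wordEval w (g :: s) =
        letterEval z g * (wordEval z s - wordEval w s) +
          (letterEval z g - letterEval w g) * wordEval w s := by
      simp only [wordEval, List.map_cons, List.prod_cons]; noncomm_ring
    have h1 : ‖letterEval z g * (wordEval z s - wordEval w s)‖ ≤
        M * (s.length * (M : ℝ) ^ s.length * δ) :=
      (norm_mul_le _ _).trans
        (mul_le_mul ((norm_letterEval z g).trans_le (hz _)) ih (norm_nonneg _) (Nat.cast_nonneg _))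
    have h2 : ‖(letterEval z g - letterEval w g) * wordEval w s‖ ≤ δ * (M : ℝ) ^ s.length :=
      (norm_mul_le _ _).trans (mul_le_mul hg (norm_wordEval_le hw s) (norm_nonneg _) hδ)
    have h3 : δ * (M : ℝ) ^ s.length ≤ δ * (M : ℝ) ^ (s.length + 1) := by gcongr; omega
    rw [e]
    refine (norm_add_le _ _).trans ((add_le_add h1 (h2.trans h3)).trans_eq ?_)
    rw [List.length_cons]
    push_cast
    ring

theorem norm_polyEval_sub_le (hM : 1 ≤ M) (hz : ∀ k, ‖z k‖ ≤ M) (hw : ∀ k, ‖w k‖ ≤ M)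
    (hzw : ∀ k, ‖z k - w k‖ ≤ δ) (p : RatStarPoly n) :
    ‖polyEval p z - polyEval p w‖ ≤ lipschitzBound M p * δ := by
  induction p with
  | nil => simp [polyEval, lipschitzBound]
  | cons t p ih =>
    have e : polyEval (t :: p) z - polyEval (t :: p) w =
        t.1.toComplex • (wordEval z t.2 - wordEval w t.2) + (polyEval p z - polyEval p w) := by
      simp only [polyEval, List.map_cons, List.sum_cons, smul_sub]; abel
    have e' : lipschitzBound M (t :: p) = (t.1.1.1.natAbs + t.1.1.2.natAbs) *
        (t.2.length * M ^ t.2.length) + lipschitzBound M p := rfl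
    have hc : ‖t.1.toComplex‖ ≤ (t.1.1.1.natAbs + t.1.1.2.natAbs : ℕ) := by
      refine (BoundCode.norm_toComplex_le t.1).trans (div_le_self (Nat.cast_nonneg _) ?_)
      exact le_add_of_nonneg_left (Nat.cast_nonneg _)
    rw [e, e']
    refine (norm_add_le _ _).trans ?_
    rw [norm_smul]
    refine (add_le_add (mul_le_mul hc (norm_wordEval_sub_le hM hz hw hzw t.2) (norm_nonneg _)
      (Nat.cast_nonneg _)) ih).trans_eq ?_
    push_cast
    ring

end Lipschitz
end FinCStar

/-! ### Transfer of weak stability along a computable isomorphism. -/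

namespace FinCStar
open RatStarPoly

/-- The norm estimates on a tuple `q` of rational `*`-polynomials that make its value a
`2⁻ᴳ`-approximate representation of `R` and the tuple `u` an approximate inverse of `q`. -/
def inverseBounds {j l : ℕ} (R : FinRelations j) (γ : Fin j → BoundCode)
    (a : (Fin l → RatStarPoly j) × ℕ × ℕ) (q : Fin j → RatStarPoly l) :
    List (RatStarPoly l × BoundCode) :=
  (R.rels.map fun p => (subst q p, BoundCode.twoPow a.2.1)) ++
    ((List.finRange j).map fun k => (q k, (γ k).add (BoundCode.twoPow a.2.1))) ++
    (List.finRange l).map fun k =>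
      (subst q (a.1 k) ++ neg (letter (k, false)), BoundCode.twoPow a.2.2)

theorem primrec_inverseBounds {j l : ℕ} (R : FinRelations j) (γ : Fin j → BoundCode) :
    Primrec₂ (inverseBounds (l := l) R γ) := by
  let X := ((Fin l → RatStarPoly j) × ℕ × ℕ) × (Fin j → RatStarPoly l)
  have hq : Primrec (fun x : X => x.2) := Primrec.snd
  have hu : Primrec (fun x : X => x.1.1) := Primrec.fst.comp Primrec.fst
  have hG : Primrec (fun x : X => BoundCode.twoPow x.1.2.1) :=
    BoundCode.primrec_twoPow.comp (Primrec.fst.comp (Primrec.snd.comp Primrec.fst))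
  have hN : Primrec (fun x : X => BoundCode.twoPow x.1.2.2) :=
    BoundCode.primrec_twoPow.comp (Primrec.snd.comp (Primrec.snd.comp Primrec.fst))
  refine Primrec.list_append.comp (Primrec.list_append.comp
    (Primrec.list_map (α := X) (Primrec.const R.rels) ?_)
    (Primrec.list_map (α := X) (Primrec.const (List.finRange j)) ?_))
    (Primrec.list_map (α := X) (Primrec.const (List.finRange l)) ?_)
  · exact (primrec_subst.comp (hq.comp Primrec.fst) Primrec.snd).pair (hG.comp Primrec.fst)
  · exact (Primrec.fin_app.comp (hq.comp Primrec.fst) Primrec.snd).pair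
      (BoundCode.primrec_add.comp ((Primrec.dom_finite γ).comp Primrec.snd) (hG.comp Primrec.fst))
  · exact (Primrec.list_append.comp
      (primrec_subst.comp (hq.comp Primrec.fst) (Primrec.fin_app.comp (hu.comp Primrec.fst) Primrec.snd))
      ((Primrec.dom_finite fun k => neg (letter (k, false))).comp Primrec.snd)).pair
      (hN.comp Primrec.fst)

/-- An element with approximate coordinates `u` is recovered from an approximate preimage. -/
theorem exists_inverseBounds_lt {j l : ℕ} {A : Type u} [CStarAlgebra A]
    (P : FinCEPresentation A j) (Q : FinCEPresentation A l) (ψ : A ≃⋆ₐ[ℂ] A)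
    {γ : Fin j → BoundCode} (hγ : ∀ k, (γ k).val = P.toRelations.bound k)
    (u : Fin l → RatStarPoly j) (G N : ℕ)
    (hu : ∀ k, ‖ψ (Q.pt k) - polyEval (u k) P.pt‖ < (1 / 2 : ℝ) ^ N) :
    ∃ q : Fin j → RatStarPoly l, ∀ t ∈ inverseBounds P.toRelations γ (u, G, N) q,
      ‖polyEval t.1 Q.pt‖ < t.2.val := by
  have hG : (0 : ℝ) < (1 / 2 : ℝ) ^ G := by positivity
  let x : Fin j → A := fun k => (ψ.symm : A →⋆ₐ[ℂ] A) (P.pt k)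
  have hx (p : RatStarPoly j) : polyEval p x = ψ.symm (polyEval p P.pt) :=
    (map_polyEval P.pt (ψ.symm : A →⋆ₐ[ℂ] A) p).symm
  -- All requirements on `q(y)` are strict and hold at `ψ⁻¹(x)`, so they define an open
  -- neighbourhood of it, which density lets a rational tuple enter.
  let U : Set (Fin j → A) :=
    {w | ∀ p ∈ P.toRelations.rels, ‖polyEval p w‖ < (1 / 2 : ℝ) ^ G} ∩
      ({w | ∀ k, ‖w k‖ < P.toRelations.bound k + (1 / 2 : ℝ) ^ G} ∩
        {w | ∀ k, ‖polyEval (u k) w - Q.pt k‖ < (1 / 2 : ℝ) ^ N})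
  have hU : IsOpen U := by
    refine IsOpen.inter ?_ (IsOpen.inter ?_ ?_)
    · have : {w : Fin j → A | ∀ p ∈ P.toRelations.rels, ‖polyEval p w‖ < (1 / 2 : ℝ) ^ G} =
          ⋂ p ∈ {p | p ∈ P.toRelations.rels}, {w | ‖polyEval p w‖ < (1 / 2 : ℝ) ^ G} := by
        ext w; simp
      rw [this]
      exact P.toRelations.rels.finite_toSet.isOpen_biInter fun p _ =>
        isOpen_lt (continuous_polyEval p).norm continuous_const
    · rw [Set.ofPred_forall]
      exact isOpen_iInter_of_finite fun k =>
        isOpen_lt (continuous_apply k).norm continuous_const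
    · rw [Set.ofPred_forall]
      exact isOpen_iInter_of_finite fun k =>
        isOpen_lt ((continuous_polyEval (u k)).sub continuous_const).norm continuous_const
  have hxU : x ∈ U := by
    refine ⟨fun p hp => ?_, fun k => ?_, fun k => ?_⟩
    · rw [hx, P.isUniversal.1.1 p hp, map_zero, norm_zero]; exact hG
    · exact (NonUnitalStarAlgHom.norm_apply_le (ψ.symm : A →⋆ₐ[ℂ] A) _).trans_lt
        ((P.isUniversal.1.2 k).trans_lt (lt_add_of_pos_right _ hG))
    · have e : polyEval (u k) x - Q.pt k =
          (ψ.symm : A →⋆ₐ[ℂ] A) (polyEval (u k) P.pt - ψ (Q.pt k)) := by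
        rw [map_sub, hx]
        exact congrArg _ (ψ.symm_apply_apply _).symm
      rw [e]
      exact (NonUnitalStarAlgHom.norm_apply_le (ψ.symm : A →⋆ₐ[ℂ] A) _).trans_lt
        ((norm_sub_rev _ _).trans_lt (hu k))
  obtain ⟨q, hq1, hq2, hq3⟩ := (DenseRange.piMap fun _ : Fin j =>
    Q.isUniversal.denseRange_polyEval).exists_mem_open hU ⟨x, hxU⟩
  refine ⟨q, fun t ht => ?_⟩
  rcases List.mem_append.1 ht with ht | ht
  · rcases List.mem_append.1 ht with ht | ht
    · obtain ⟨p, hp, rfl⟩ := List.mem_map.1 ht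
      rw [polyEval_subst, BoundCode.val_twoPow]
      exact hq1 p hp
    · obtain ⟨k, -, rfl⟩ := List.mem_map.1 ht
      rw [BoundCode.val_add, BoundCode.val_twoPow, hγ]
      exact hq2 k
  · obtain ⟨k, -, rfl⟩ := List.mem_map.1 ht
    rw [polyEval_append, polyEval_neg, polyEval_subst, polyEval_letter, BoundCode.val_twoPow,
      ← sub_eq_add_neg]
    exact hq3 k

theorem FinCEPresentation.ComputablyWeaklyStable.of_isComputableMap {j l : ℕ} {A : Type u}
    [CStarAlgebra A] {P : FinCEPresentation A j} {Q : FinCEPresentation A l} (ψ : A ≃⋆ₐ[ℂ] A)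
    (hψ : IsComputableMap Q.pt P.pt (ψ : A →⋆ₐ[ℂ] A)) (hP : P.ComputablyWeaklyStable) :
    Q.ComputablyWeaklyStable := by
  obtain ⟨F, hF, hFψ⟩ := hψ
  obtain ⟨g, hg, hgP⟩ := hP
  obtain ⟨γ, hγ⟩ := P.toRelations.exists_bound_codes
  -- The extra `1` absorbs the tolerance, so `M` bounds approximate representations of `P` as well
  -- as exact ones.
  obtain ⟨M, hM1, hM⟩ : ∃ M : ℕ, 1 ≤ M ∧ ∀ k, P.toRelations.bound k + 1 ≤ M := by
    refine ⟨1 + ∑ k, ⌈P.toRelations.bound k + 1⌉₊, Nat.le_add_right _ _, fun k => ?_⟩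
    refine (Nat.le_ceil _).trans (Nat.cast_le.2 ?_)
    exact (Finset.single_le_sum (f := fun k => ⌈P.toRelations.bound k + 1⌉₊)
      (fun _ _ => Nat.zero_le _) (Finset.mem_univ k)).trans (Nat.le_add_left _ _)
  let U : ℕ → Fin l → RatStarPoly j := fun n k => F (letter (k, false), n + 2)
  have hU : Computable U := by
    have h1 : Computable fun n => List.Vector.ofFn (U n) :=
      Computable.vector_ofFn fun k => hF.comp ((Computable.const _).pair
        (Primrec.nat_add.comp Primrec.id (Primrec.const 2)).to_comp)
    have h2 : Primrec fun (v : List.Vector (RatStarPoly j) l) (k : Fin l) => v.get k :=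
      Primrec.fin_curry.2 Primrec.vector_get
    refine (h2.to_comp.comp h1).of_eq fun n => ?_
    funext k
    simp
  let Lip : (Fin l → RatStarPoly j) → ℕ := fun u =>
    ((List.finRange l).map fun k => lipschitzBound M (u k)).sum
  have hLip : Primrec Lip := by
    refine Primrec.list_foldr (α := Fin l → RatStarPoly j) (h := fun _ x => x.1 + x.2)
      (Primrec.list_map (Primrec.const _) ((primrec_lipschitzBound M).comp Primrec.fin_app))
      (Primrec.const 0) (Primrec.nat_add.comp (Primrec.fst.comp Primrec.snd)
        (Primrec.snd.comp Primrec.snd))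
  have hLipU (u : Fin l → RatStarPoly j) (k) : lipschitzBound M (u k) ≤ Lip u :=
    List.le_sum_of_mem (List.mem_map.2 ⟨k, List.mem_finRange k, rfl⟩)
  -- Since `L ≤ 2 ^ L`, an error `2⁻ᴺ` in the arguments of `U n` gives an error of at most `2⁻⁽ⁿ⁺²⁾`
  -- in the values.
  let N : ℕ → ℕ := fun n => n + 2 + Lip (U n)
  have hN : Computable N :=
    Primrec.nat_add.to_comp.comp (Primrec.nat_add.comp Primrec.id (Primrec.const 2)).to_comp
      (hLip.to_comp.comp hU)
  let a : ℕ → (Fin l → RatStarPoly j) × ℕ × ℕ := fun n => (U n, g (N n), n + 2)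
  have ha : Computable a := hU.pair ((hg.comp hN).pair
    (Primrec.nat_add.comp Primrec.id (Primrec.const 2)).to_comp)
  have hUψ (n : ℕ) (k : Fin l) : ‖ψ (Q.pt k) - polyEval (U n k) P.pt‖ < (1 / 2 : ℝ) ^ (n + 2) := by
    have := hFψ (letter (k, false)) (n + 2)
    rwa [polyEval_letter] at this
  obtain ⟨f, hf, hfQ⟩ := Q.toRelations.exists_computable_modulus Q.isUniversal
    (primrec_inverseBounds P.toRelations γ) ha fun n =>
      exists_inverseBounds_lt P Q ψ hγ (U n) (g (N n)) (n + 2) (hUψ n)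
  refine ⟨fun n => (f n).2, Computable.snd.comp hf, fun n B _ z hz => ?_⟩
  have hbd := hfQ n B z hz
  let w : Fin j → B := fun k => polyEval ((f n).1 k) z
  have hw : P.toRelations.IsApproxRep ((1 / 2 : ℝ) ^ g (N n)) w := by
    refine ⟨fun p hp => ?_, fun k => ?_⟩
    · have := hbd _ (List.mem_append_left _ (List.mem_append_left _
        (List.mem_map.2 ⟨p, hp, rfl⟩)))
      rwa [polyEval_subst, BoundCode.val_twoPow] at this
    · have := hbd _ (List.mem_append_left _ (List.mem_append_right _
        (List.mem_map.2 ⟨k, List.mem_finRange k, rfl⟩)))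
      rwa [BoundCode.val_add, BoundCode.val_twoPow, hγ] at this
  obtain ⟨θ, hθ⟩ := hgP (N n) B w hw
  refine ⟨θ.comp (ψ : A →⋆ₐ[ℂ] A), fun k => ?_⟩
  have h1 : ‖θ (ψ (Q.pt k)) - polyEval (U n k) fun i => θ (P.pt i)‖ < (1 / 2 : ℝ) ^ (n + 2) := by
    rw [← map_polyEval, ← map_sub]
    exact (NonUnitalStarAlgHom.norm_apply_le θ _).trans_lt (hUψ n k)
  have h2 : ‖polyEval (U n k) (fun i => θ (P.pt i)) - polyEval (U n k) w‖ ≤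
      (1 / 2 : ℝ) ^ (n + 2) := by
    have hle := norm_polyEval_sub_le hM1 (z := fun i => θ (P.pt i)) (w := w)
      (δ := (1 / 2 : ℝ) ^ N n)
      (fun i => (NonUnitalStarAlgHom.norm_apply_le θ _).trans
        ((P.isUniversal.1.2 i).trans ((le_add_of_nonneg_right zero_le_one).trans (hM i))))
      (fun i => (hw.2 i).trans ((add_le_add le_rfl
        (pow_le_one₀ (by norm_num) (by norm_num))).trans (hM i)))
      (fun i => (hθ i).le) (U n k)
    have hlt : (lipschitzBound M (U n k) : ℝ) ≤ 2 ^ Lip (U n) := by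
      exact_mod_cast (hLipU (U n) k).trans Nat.lt_two_pow_self.le
    refine hle.trans ((mul_le_mul_of_nonneg_right hlt (by positivity)).trans_eq ?_)
    simp only [N]
    rw [pow_add _ (n + 2), mul_left_comm, ← mul_pow]
    norm_num
  have h3 : ‖polyEval (U n k) w - z k‖ ≤ (1 / 2 : ℝ) ^ (n + 2) := by
    have := hbd _ (List.mem_append_right _ (List.mem_map.2 ⟨k, List.mem_finRange k, rfl⟩))
    rwa [polyEval_append, polyEval_neg, polyEval_subst, polyEval_letter, BoundCode.val_twoPow,
      ← sub_eq_add_neg] at this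
  have e : (1 / 2 : ℝ) ^ (n + 2) = (1 / 2 : ℝ) ^ n / 4 := by rw [pow_add]; norm_num [div_eq_mul_inv]
  have hpos : (0 : ℝ) < (1 / 2 : ℝ) ^ n := by positivity
  -- Three errors of a quarter of `2⁻ⁿ` each leave the total strictly below `2⁻ⁿ`.
  have h4 := (norm_sub_le_norm_sub_add_norm_sub (θ (ψ (Q.pt k)))
    (polyEval (U n k) fun i => θ (P.pt i)) (z k)).trans (add_le_add h1.le
      ((norm_sub_le_norm_sub_add_norm_sub _ (polyEval (U n k) w) (z k)).trans (add_le_add h2 h3)))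
  refine lt_of_le_of_lt h4 ?_
  rw [e]
  linarith

/-- Names of rational points depend on the tuple and not on the relations, so a common tuple makes
the identity computable; this gives independence of the relations. -/
theorem isComputableMap_refl {n : ℕ} {A : Type u} [CStarAlgebra A] (x : Fin n → A) :
    IsComputableMap x x ((StarAlgEquiv.refl ℂ A : A ≃⋆ₐ[ℂ] A) : A →⋆ₐ[ℂ] A) :=
  ⟨Prod.fst, Computable.fst, fun p k => by
    change ‖polyEval p x - polyEval p x‖ < _
    simp⟩

end FinCStar

theorem mainTheorem4 {A : Type u} [CStarAlgebra A] {j l : ℕ}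
    (P : FinCStar.FinCEPresentation A j) (Q : FinCStar.FinCEPresentation A l) :
    -- the lemma: an isomorphism computable from `Q` to `P` carries the property from `P` to `Q`
    ((∃ ψ : A ≃⋆ₐ[ℂ] A, FinCStar.IsComputableMap Q.pt P.pt (ψ : A →⋆ₐ[ℂ] A)) →
      P.ComputablyWeaklyStable → Q.ComputablyWeaklyStable) ∧
    -- invariance under isomorphisms that are computable in both directions
    ((∃ ψ : A ≃⋆ₐ[ℂ] A, FinCStar.IsComputableMap Q.pt P.pt (ψ : A →⋆ₐ[ℂ] A) ∧
        FinCStar.IsComputableMap P.pt Q.pt (ψ.symm : A →⋆ₐ[ℂ] A)) →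
      (P.ComputablyWeaklyStable ↔ Q.ComputablyWeaklyStable)) ∧
    -- independence of the finite set of rational relations that gives the same presentation
    (∀ P' : FinCStar.FinCEPresentation A j, P'.pt = P.pt →
      (P.ComputablyWeaklyStable ↔ P'.ComputablyWeaklyStable)) := by
  refine ⟨fun ⟨ψ, hψ⟩ hP => hP.of_isComputableMap ψ hψ, fun ⟨ψ, h1, h2⟩ =>
    ⟨fun hP => hP.of_isComputableMap ψ h1, fun hQ => hQ.of_isComputableMap ψ.symm h2⟩,
    fun P' h => ⟨fun hP => hP.of_isComputableMap (.refl ℂ A) ?_,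
      fun hP' => hP'.of_isComputableMap (.refl ℂ A) ?_⟩⟩
  · rw [h]; exact FinCStar.isComputableMap_refl P.pt
  · rw [h]; exact FinCStar.isComputableMap_refl P.pt
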